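/- Let $\Omega\subset\mathbb R^d$ ($d\ge 1$) be open and bounded, $V=H_0^1(\Omega)$, $a(u,v)=\int_\Omega\nabla u\cdot\nabla v$, $b(u,v)=\int_\Omega uv$, $\|v\|_a=\sqrt{a(v,v)}$. Let $\lambda_1\le\lambda_2\le\cdots$ be the eigenvalues, repeated according to geometric multiplicity, of the problem $a(u,v)=\lambda b(u,v)$ for all $v\in V$, and let $M(\lambda)=\{w\in V: a(w,v)=\lambda b(w,v)\ \forall v\in V\}$. Let $m\ge 1$ with $\lambda_m<\lambda_{m+1}$. **Theorem.** There are $\delta>0$ and $\alpha>0$, depending only on $\Omega$ and $m$, such that the following holds for all $u_{0,1},\dots,u_{0,m}\in V$ that satisfy $b(u_{0,i},u_{0,j})=\delta_{ij}$ and are $\delta$-close to the eigenspaces, in the sense that for each $j\le m$ there is $w\in M(\lambda_j)$ with $\|u_{0,j}-w\|_a\le\delta$. Put $\mu_j=a(u_{0,j},u_{0,j})/b(u_{0,j},u_{0,j})$, $A_{\mu_j}(u,v)=a(u,v)-\mu_j b(u,v)$, $B(v,y)=-\sum_{i=1}^m y_i b(u_{0,i},v)$ for $v\in V$, $y\in\mathbb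 R^m$, $\|y\|=\max_i|y_i|$, and $V_0=\{v\in V: B(v,y)=0\ \forall y\in\mathbb R^m\}$. Then: 1. $V_0=\{v\in V: b(u_{0,i},v)=0,\ i=1,\dots,m\}$, and for each $j\le m$, $A_{\mu_j}(v,v)\ge\alpha\|v\|_a^2$ for all $v\in V_0$. 2. With $\mu=\max_{t\le m}\mu_t>0$, $\displaystyle\sup_{0\ne v\in V}\frac{B(v,y)}{\|v\|_a}\ge\frac{1}{\sqrt{\mu}}\,\|y\|$ for all $y\in\mathbb R^m$ (the supremum being finite). In particular, if $\mu\ge1$, this holds with the constant $1/\mu$ in place of $1/\sqrt\mu$. 3. For each $j\le m$ there is exactly one $(x,\widetilde u)\in\mathbb R^m\times V$ with $$A_{\mu_j}(\widetilde u,v)+B(v,x)=-\mu_j b(u_{0,j},v)\ \ \forall v\in V,\qquad B(\widetilde u,y)=-\sum_{i=1}^m y_i b(u_{0,i},u_{0,j})\ \ \forall y\in\mathbb R^m.$$ -/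

import Mathlib

open MeasureTheory
open scoped ContDiff

namespace NewtonEig

noncomputable section

/-- The Euclidean space `ℝ^d`. -/
abbrev Euc (d : ℕ) : Type := EuclideanSpace ℝ (Fin d)

/-- `L²(Ω) × L²(Ω; ℝ^d)` with its Hilbert norm `(‖u‖² + ‖p‖²)^{1/2}`. The space `H¹(Ω)` sits in it
isometrically through `u ↦ (u, ∇u)`. -/
abbrev L2Pair {d : ℕ} (Ω : Set (Euc d)) : Type :=
  WithLp 2 (Lp ℝ 2 (volume.restrict Ω) × Lp (Euc d) 2 (volume.restrict Ω))

/-- `φ ∈ C_c^∞(Ω)`. -/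
structure IsTest {d : ℕ} (Ω : Set (Euc d)) (φ : Euc d → ℝ) : Prop where
  smooth : ContDiff ℝ ∞ φ
  compact : HasCompactSupport φ
  supp : tsupport φ ⊆ Ω

/-- The pairs `(φ, ∇φ)` with `φ ∈ C_c^∞(Ω)`. -/
def testGraph {d : ℕ} (Ω : Set (Euc d)) : Submodule ℝ (L2Pair Ω) where
  carrier := {p | ∃ φ : Euc d → ℝ, IsTest Ω φ ∧
    p.fst =ᵐ[volume.restrict Ω] φ ∧ p.snd =ᵐ[volume.restrict Ω] gradient φ}
  zero_mem' := by
    refine ⟨0, ⟨contDiff_const, HasCompactSupport.zero, by simp [tsupport]⟩, ?_, ?_⟩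
    · exact Lp.coeFn_zero ℝ 2 _
    · have h : gradient (0 : Euc d → ℝ) = 0 := by
        funext x
        simp [gradient]
      rw [h]
      exact Lp.coeFn_zero (Euc d) 2 _
  add_mem' := by
    rintro p q ⟨φ, hφ, h1, h2⟩ ⟨ψ, hψ, k1, k2⟩
    refine ⟨φ + ψ, ⟨hφ.smooth.add hψ.smooth, hφ.compact.add hψ.compact,
      (tsupport_add φ ψ).trans (Set.union_subset hφ.supp hψ.supp)⟩, ?_, ?_⟩
    · exact (Lp.coeFn_add p.fst q.fst).trans (h1.add k1)
    · have h : gradient (φ + ψ) = gradient φ + gradient ψ := by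
        funext x
        simp only [gradient, Pi.add_apply]
        rw [fderiv_add (hφ.smooth.differentiable (by simp) x)
          (hψ.smooth.differentiable (by simp) x), map_add]
      rw [h]
      exact (Lp.coeFn_add p.snd q.snd).trans (h2.add k2)
  smul_mem' := by
    rintro c p ⟨φ, hφ, h1, h2⟩
    refine ⟨c • φ, ⟨contDiff_const.smul hφ.smooth, hφ.compact.smul_left,
      (tsupport_smul_subset_right (fun _ => c) φ).trans hφ.supp⟩, ?_, ?_⟩
    · exact (Lp.coeFn_smul c p.fst).trans (h1.const_smul c)
    · have h : gradient (c • φ) = c • gradient φ := by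
        funext x
        simp only [gradient, Pi.smul_apply]
        rw [fderiv_const_smul (hφ.smooth.differentiable (by simp) x), map_smulₛₗ]
        simp
      rw [h]
      exact (Lp.coeFn_smul c p.snd).trans (h2.const_smul c)

/-- The Sobolev space `V = H_0^1(Ω)`: the closure of `C_c^∞(Ω)` for the `H¹` norm. An element `u`
is recorded as the pair of `u.1.fst`, the `L²` function, and `u.1.snd`, its weak gradient (limits of
pairs `(φₙ, ∇φₙ)` satisfy the integration by parts formula, so the first component determines the
second). -/
def H10 {d : ℕ} (Ω : Set (Euc d)) : Submodule ℝ (L2Pair Ω) := (testGraph Ω).topologicalClosure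

/-- `a(u,v) = ∫_Ω ∇u · ∇v`. -/
def aForm {d : ℕ} {Ω : Set (Euc d)} (u v : H10 Ω) : ℝ :=
  ∫ x in Ω, inner ℝ (u.1.snd x) (v.1.snd x)

/-- `b(u,v) = ∫_Ω u v`. -/
def bForm {d : ℕ} {Ω : Set (Euc d)} (u v : H10 Ω) : ℝ :=
  ∫ x in Ω, u.1.fst x * v.1.fst x

/-- `‖v‖_a`. -/
def aNorm {d : ℕ} {Ω : Set (Euc d)} (v : H10 Ω) : ℝ := Real.sqrt (aForm v v)

theorem aForm_eq_inner {d : ℕ} {Ω : Set (Euc d)} (u v : H10 Ω) :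
    aForm u v = inner ℝ u.1.snd v.1.snd := by
  rw [L2.inner_def]; rfl

theorem bForm_eq_inner {d : ℕ} {Ω : Set (Euc d)} (u v : H10 Ω) :
    bForm u v = inner ℝ u.1.fst v.1.fst := by
  rw [L2.inner_def]
  simp [bForm, mul_comm]

/-- `M(t)`: the eigenfunctions for the value `t` (together with `0`), i.e. the `w ∈ V` with
`a(w,v) = t b(w,v)` for all `v ∈ V`. It is `{0}` if `t` is not an eigenvalue. -/
def eigenspace {d : ℕ} (Ω : Set (Euc d)) (t : ℝ) : Submodule ℝ (H10 Ω) where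
  carrier := {w | ∀ v : H10 Ω, aForm w v = t * bForm w v}
  zero_mem' := by
    intro v
    simp [aForm_eq_inner, bForm_eq_inner]
  add_mem' := by
    intro w z hw hz v
    have h1 := hw v
    have h2 := hz v
    rw [aForm_eq_inner, bForm_eq_inner] at h1 h2 ⊢
    simp only [Submodule.coe_add, WithLp.add_fst, WithLp.add_snd, inner_add_left]
    rw [h1, h2]; ring
  smul_mem' := by
    intro c w hw v
    have h1 := hw v
    rw [aForm_eq_inner, bForm_eq_inner] at h1 ⊢
    simp only [Submodule.coe_smul, WithLp.smul_fst, WithLp.smul_snd, real_inner_smul_left]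
    rw [h1]; ring

/-- `λ_k` (`k ≥ 1`): the `k`-th eigenvalue in increasing order, counted with geometric
multiplicity, i.e. the infimum of the `t` for which there are `k` linearly independent eigenfunctions with
eigenvalues at most `t`. -/
def eigenvalue {d : ℕ} (Ω : Set (Euc d)) (k : ℕ) : ℝ :=
  sInf {t : ℝ | ∃ w : Fin k → H10 Ω, LinearIndependent ℝ w ∧ ∀ i, ∃ s ≤ t, w i ∈ eigenspace Ω s}

/-- The Rayleigh quotient. -/
def rayleigh {d : ℕ} {Ω : Set (Euc d)} (u : H10 Ω) : ℝ := aForm u u / bForm u u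

/-- `A_μ(u,v) = a(u,v) - μ b(u,v)`. -/
def shiftedForm {d : ℕ} {Ω : Set (Euc d)} (μ : ℝ) (u v : H10 Ω) : ℝ := aForm u v - μ * bForm u v

/-- `B(v,y) = - ∑ i, y_i b(u_{0,i}, v)`, for `v ∈ V` and `y ∈ W = ℝ^m`. -/
def constraintForm {d : ℕ} {Ω : Set (Euc d)} {m : ℕ} (u₀ : Fin m → H10 Ω) (v : H10 Ω)
    (y : Fin m → ℝ) : ℝ :=
  -∑ i, y i * bForm (u₀ i) v

/-- `(x, u) ∈ ℝ^m × V` solves the `j`-th Newton saddle-point problem: with `μ_j` the Rayleigh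
quotient of `u_{0,j}`,
`A_{μ_j}(u,v) + B(v,x) = -μ_j b(u_{0,j},v)` for all `v ∈ V`, and
`B(u,y) = -∑ i, y_i b(u_{0,i},u_{0,j})` for all `y ∈ ℝ^m`. -/
def SolvesNewton {d : ℕ} {Ω : Set (Euc d)} {m : ℕ} (u₀ : Fin m → H10 Ω) (j : Fin m)
    (x : Fin m → ℝ) (u : H10 Ω) : Prop :=
  (∀ v : H10 Ω, shiftedForm (rayleigh (u₀ j)) u v + constraintForm u₀ v x =
      -(rayleigh (u₀ j)) * bForm (u₀ j) v) ∧
  (∀ y : Fin m → ℝ, constraintForm u₀ u y = -∑ i, y i * bForm (u₀ i) (u₀ j))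

end

end NewtonEig

/-! Everything rests on a spectral gap. The eigenfunctions w_j near the u_{0,j} are linearly
independent, with eigenvalues at most λ_m. Suppose some z, b-orthogonal to all w_j, had Rayleigh
quotient below λ_{m+1}. The embedding into L² is compact, so its restriction to this complement has
a top singular vector. That vector is an eigenfunction with eigenvalue below λ_{m+1}, and together
with the w_j it gives m + 1 independent ones, contradicting the definition of λ_{m+1} as an infimum
(`eigenvalue_mul_le`). No full spectral theorem is needed.

Replacing the complement of the w_j by V₀ lowers the gap constant to N = λ_{m+1}(1 - (2mCδ)²), with
C the Poincaré constant (`gap_of_near`), while μ_j ≤ M = (√λ_m (1 + Cδ) + δ)². At δ = 0 these are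
λ_{m+1} and λ_m, so M < N for small δ, and α = 1 - M/N works. The inf-sup bound comes from testing
with ±u_{0,i}, whose a-norm is √μ_i. Unique solvability is Lax–Milgram on V₀, the multipliers being
read off by testing with u_{0,i}.

The analytic inputs, Poincaré and Rellich, both follow from ‖φ(· + z) - φ‖ ≤ ‖z‖ ‖∇φ‖ in L²
(`lintegral_translate_sub_sq_le`). A translation that moves Ω off itself gives Poincaré; averaging
over small cubes approximates the embedding by finite-rank operators, which gives compactness. -/

namespace NewtonEig

/-! ### Eigenvectors from compactness, in Hilbert space. -/

section Abstract

variable {V H G : Type*} [NormedAddCommGroup V] [InnerProductSpace ℝ V] [CompleteSpace V]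
  [NormedAddCommGroup H] [InnerProductSpace ℝ H] [CompleteSpace H]
  [NormedAddCommGroup G] [InnerProductSpace ℝ G]

/-- A nonzero compact operator between Hilbert spaces has a singular vector for its largest singular
value. -/
theorem exists_singular_vector (T : V →L[ℝ] H) (hT : IsCompactOperator T) (h0 : T ≠ 0) :
    ∃ z : V, z ≠ 0 ∧ ∀ v, inner ℝ (T z) (T v) = ‖T‖ ^ 2 * inner ℝ z v := by
  -- The maximiser `y` of the norm over `K` is only a limit of images of the unit ball; the singular
  -- vector is `T* y`, so no preimage of `y` is needed.
  set K := closure (T '' Metric.closedBall 0 1) with hK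
  have hKc : IsCompact K := hT.isCompact_closure_image_closedBall 1
  have hKn : K.Nonempty := ⟨T 0, subset_closure ⟨0, by simp, rfl⟩⟩
  obtain ⟨y, hyK, hy⟩ := hKc.exists_isMaxOn hKn continuous_norm.continuousOn
  have hyT : ‖T‖ ≤ ‖y‖ := by
    refine ContinuousLinearMap.opNorm_le_of_unit_norm (norm_nonneg y) fun v hv => ?_
    exact hy (subset_closure ⟨v, by simp [hv], rfl⟩)
  have hyT' : ‖y‖ ≤ ‖T‖ := by
    have : K ⊆ Metric.closedBall 0 ‖T‖ := by
      refine closure_minimal ?_ Metric.isClosed_closedBall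
      rintro _ ⟨v, hv, rfl⟩
      simp only [mem_closedBall_zero_iff] at hv ⊢
      exact T.unit_le_opNorm v hv
    simpa using this hyK
  have hnorm : ‖y‖ = ‖T‖ := le_antisymm hyT' hyT
  set z := ContinuousLinearMap.adjoint T y with hz
  have hadj : ∀ v, inner ℝ z v = inner ℝ y (T v) := fun v =>
    ContinuousLinearMap.adjoint_inner_left T v y
  have hz1 : ‖T‖ ^ 2 ≤ ‖z‖ := by
    have : K ⊆ {x | inner ℝ y x ≤ ‖z‖} := by
      refine closure_minimal ?_ (isClosed_le (by fun_prop) continuous_const)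
      rintro _ ⟨v, hv, rfl⟩
      simp only [mem_closedBall_zero_iff] at hv
      change inner ℝ y (T v) ≤ ‖z‖
      rw [← hadj]
      exact (real_inner_le_norm _ _).trans (mul_le_of_le_one_right (norm_nonneg _) hv)
    have h := this hyK
    simp only [Set.mem_ofPred_eq, real_inner_self_eq_norm_sq, hnorm] at h
    exact h
  have hz2 : ‖z‖ ≤ ‖T‖ ^ 2 := by
    have h := (ContinuousLinearMap.adjoint T).le_opNorm y
    rw [LinearIsometryEquiv.norm_map, hnorm] at h
    rw [sq]; exact h
  have hzn : ‖z‖ = ‖T‖ ^ 2 := le_antisymm hz2 hz1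
  have hTz : T z = ‖T‖ ^ 2 • y := by
    have h1 : ‖T z‖ ≤ ‖T‖ ^ 3 := by
      refine (T.le_opNorm z).trans_eq ?_
      rw [hzn]; ring
    have h2 : inner ℝ (T z) y = ‖T‖ ^ 4 := by
      rw [real_inner_comm, ← hadj, real_inner_self_eq_norm_sq, hzn]; ring
    -- Expanding the square gives at most ‖T‖⁶ - 2‖T‖⁶ + ‖T‖⁶: equality in Cauchy–Schwarz.
    have h3 : ‖T z - ‖T‖ ^ 2 • y‖ ^ 2 ≤ 0 := by
      rw [norm_sub_sq_real, inner_smul_right, h2, norm_smul, hnorm]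
      have h4 : ‖T z‖ ^ 2 ≤ (‖T‖ ^ 3) ^ 2 := by gcongr
      simp only [norm_pow, norm_norm]
      nlinarith [h4]
    have h4 : ‖T z - ‖T‖ ^ 2 • y‖ = 0 := by
      nlinarith [norm_nonneg (T z - ‖T‖ ^ 2 • y)]
    exact sub_eq_zero.1 (norm_eq_zero.1 h4)
  refine ⟨z, ?_, fun v => ?_⟩
  · rw [← norm_pos_iff, hzn]
    have : 0 < ‖T‖ := norm_pos_iff.2 h0
    positivity
  · rw [hTz, real_inner_smul_left, hadj]

/-- Every vector is, modulo the span of finitely many `w i`, orthogonal to all of them for the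
semi-inner product `⟪T u, T v⟫`. -/
theorem exists_sub_sum_orthogonal {V H : Type*} [AddCommGroup V] [Module ℝ V]
    [NormedAddCommGroup H] [InnerProductSpace ℝ H] {n : Type*} [Fintype n] (T : V →ₗ[ℝ] H)
    (w : n → V) (v : V) :
    ∃ c : n → ℝ, ∀ i, inner ℝ (T (w i)) (T (v - ∑ k, c k • w k)) = 0 := by
  set S := Submodule.span ℝ (Set.range fun i => T (w i)) with hS
  have : FiniteDimensional ℝ S := FiniteDimensional.span_of_finite ℝ (Set.finite_range _)
  obtain ⟨c, hc⟩ := (Submodule.mem_span_range_iff_exists_fun ℝ).1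
    (S.starProjection_apply_mem (T v))
  refine ⟨c, fun i => ?_⟩
  have h := S.sub_starProjection_mem_orthogonal (T v)
  rw [← hc] at h
  have := Submodule.inner_right_of_mem_orthogonal
    (Submodule.subset_span (Set.mem_range_self i) : T (w i) ∈ S) h
  simpa using this

/-- If the form `⟪g u, g v⟫` is not bounded below by `Λ ⟪ι u, ι v⟫` on the complement of the
eigenvectors `w i`, then there is an eigenvector in this complement with an eigenvalue
below `Λ`. -/
theorem exists_eigenvector_of_lt {n : Type*} [Fintype n] (ι : V →L[ℝ] H) (g : V →L[ℝ] G)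
    (hι : IsCompactOperator ι)
    (hin : ∀ u v : V, inner ℝ u v = inner ℝ (ι u) (ι v) + inner ℝ (g u) (g v))
    (w : n → V) (t : n → ℝ)
    (hw : ∀ i v, inner ℝ (g (w i)) (g v) = t i * inner ℝ (ι (w i)) (ι v))
    {Λ : ℝ} {z : V} (hz : ∀ i, inner ℝ (ι (w i)) (ι z) = 0)
    (hlt : ‖g z‖ ^ 2 < Λ * ‖ι z‖ ^ 2) :
    ∃ z₀ : V, z₀ ≠ 0 ∧ (∀ i, inner ℝ (ι (w i)) (ι z₀) = 0) ∧
      ∃ s < Λ, ∀ v, inner ℝ (g z₀) (g v) = s * inner ℝ (ι z₀) (ι v) := by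
  let Z : Submodule ℝ V := ⨅ i, ((innerSL ℝ (ι (w i))).comp ι).ker
  have hmem : ∀ v, v ∈ Z ↔ ∀ i, inner ℝ (ι (w i)) (ι v) = 0 := fun v => by
    simp [Z, Submodule.mem_iInf]
  have hZc : IsClosed (Z : Set V) := by
    have : (Z : Set V) = ⋂ i, {v | inner ℝ (ι (w i)) (ι v) = 0} := by
      ext v; simp only [SetLike.mem_coe, hmem, Set.mem_iInter]; rfl
    rw [this]
    exact isClosed_iInter fun i => isClosed_eq (by fun_prop) continuous_const
  have : CompleteSpace Z := hZc.completeSpace_coe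
  set T : Z →L[ℝ] H := ι.comp Z.subtypeL with hT
  have hTc : IsCompactOperator T := hι.comp_clm Z.subtypeL
  have hsq : ∀ v : V, ‖v‖ ^ 2 = ‖ι v‖ ^ 2 + ‖g v‖ ^ 2 := fun v => by
    have := hin v v
    simpa only [real_inner_self_eq_norm_sq] using this
  have hzpos : 0 < ‖ι z‖ := by
    rcases (norm_nonneg (ι z)).eq_or_lt with h | h
    · rw [← h] at hlt; nlinarith [sq_nonneg ‖g z‖]
    · exact h
  have hΛ : 0 < Λ := by
    by_contra h
    nlinarith [sq_nonneg ‖g z‖, sq_nonneg ‖ι z‖]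
  have hTz : ‖ι z‖ ^ 2 ≤ ‖T‖ ^ 2 * ‖z‖ ^ 2 := by
    rw [← mul_pow]
    have h := T.le_opNorm ⟨z, (hmem z).2 hz⟩
    have h' : ‖ι z‖ ≤ ‖T‖ * ‖z‖ := h
    gcongr
  have hT0 : T ≠ 0 := by
    intro h
    have h' : ι z = T ⟨z, (hmem z).2 hz⟩ := rfl
    rw [h', h] at hzpos
    simp at hzpos
  have hTpos : 0 < ‖T‖ ^ 2 := by
    by_contra h
    nlinarith [pow_pos hzpos 2, sq_nonneg ‖z‖]
  obtain ⟨z₀, hz₀, hz₀v⟩ := exists_singular_vector T hTc hT0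
  have hz₀w := (hmem z₀).1 z₀.2
  -- With σ = ‖T‖, the singular vector relation reads b = σ²(b + a), that is, a = ((1 - σ²)/σ²) b.
  refine ⟨z₀, by simpa using hz₀, hz₀w, (1 - ‖T‖ ^ 2) / ‖T‖ ^ 2, ?_, fun v => ?_⟩
  · rw [div_lt_iff₀ hTpos]
    rw [hsq z] at hTz
    have h1 : ‖T‖ ^ 2 * (‖ι z‖ ^ 2 + ‖g z‖ ^ 2) < ‖T‖ ^ 2 * ((1 + Λ) * ‖ι z‖ ^ 2) :=
      mul_lt_mul_of_pos_left (by linarith) hTpos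
    have h2 : 1 * ‖ι z‖ ^ 2 < ‖T‖ ^ 2 * (1 + Λ) * ‖ι z‖ ^ 2 := by nlinarith
    have h3 := lt_of_mul_lt_mul_right h2 (sq_nonneg _)
    linarith
  · have hZv : ∀ x ∈ Z, inner ℝ (g z₀) (g x) =
        (1 - ‖T‖ ^ 2) / ‖T‖ ^ 2 * inner ℝ (ι z₀) (ι x) := by
      intro x hx
      have h : inner ℝ (ι z₀) (ι x) = ‖T‖ ^ 2 * inner ℝ (z₀ : V) x := hz₀v ⟨x, hx⟩
      rw [hin] at h
      rw [div_mul_eq_mul_div, eq_div_iff hTpos.ne']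
      linarith
    -- The relation is known only for test vectors in `Z`. It extends to all of `V` because both
    -- forms vanish between `z₀` and the `w k`, which are eigenvectors.
    obtain ⟨c, hc⟩ := exists_sub_sum_orthogonal ι.toLinearMap w v
    have hv := hZv _ ((hmem _).2 hc)
    have h1 : inner ℝ (ι z₀) (ι (∑ k, c k • w k)) = 0 := by
      rw [map_sum, inner_sum]
      refine Finset.sum_eq_zero fun i _ => ?_
      rw [map_smul, inner_smul_right, real_inner_comm, hz₀w, mul_zero]
    have h2 : inner ℝ (g z₀) (g (∑ k, c k • w k)) = 0 := by
      rw [map_sum, inner_sum]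
      refine Finset.sum_eq_zero fun i _ => ?_
      rw [map_smul, inner_smul_right, real_inner_comm, hw, hz₀w, mul_zero, mul_zero]
    rw [map_sub, map_sub, inner_sub_right, inner_sub_right, h1, h2, sub_zero, sub_zero] at hv
    exact hv

end Abstract

/-! ### The L² translation estimate. -/

theorem lintegral_sq_le {α : Type*} [MeasurableSpace α] (μ : Measure α) {f : α → ENNReal}
    (hf : AEMeasurable f μ) : (∫⁻ x, f x ∂μ) ^ 2 ≤ μ Set.univ * ∫⁻ x, f x ^ 2 ∂μ := by
  have h := ENNReal.lintegral_mul_le_Lp_mul_Lq μ Real.HolderConjugate.two_two hf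
    (aemeasurable_const (b := (1 : ENNReal)))
  simp only [Pi.mul_apply, mul_one, ENNReal.one_rpow, lintegral_const, one_mul] at h
  calc (∫⁻ x, f x ∂μ) ^ 2
      ≤ ((∫⁻ x, f x ^ (2 : ℝ) ∂μ) ^ (1 / 2 : ℝ) * μ Set.univ ^ (1 / 2 : ℝ)) ^ 2 := by gcongr
    _ = μ Set.univ * ∫⁻ x, f x ^ 2 ∂μ := by
      rw [mul_pow, ← ENNReal.rpow_natCast, ← ENNReal.rpow_mul, ← ENNReal.rpow_natCast,
        ← ENNReal.rpow_mul, mul_comm]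
      norm_num

theorem enorm_sq_eq_lintegral {α E : Type*} [MeasurableSpace α] [NormedAddCommGroup E]
    {μ : Measure α} (f : Lp E 2 μ) : ‖f‖ₑ ^ 2 = ∫⁻ x, ‖f x‖ₑ ^ 2 ∂μ := by
  have h := eLpNorm_nnreal_pow_eq_lintegral (f := f) (μ := μ) (p := 2) (by norm_num)
  rw [Lp.enorm_def]
  simpa using h

variable {d : ℕ}

theorem continuous_gradient {φ : Euc d → ℝ} (hφ : ContDiff ℝ 1 φ) : Continuous (gradient φ) :=
  (LinearIsometryEquiv.continuous _).comp (hφ.continuous_fderiv (by norm_num))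

theorem sub_eq_integral_gradient {φ : Euc d → ℝ} (hφ : ContDiff ℝ 1 φ) (x z : Euc d) :
    φ (x + z) - φ x = ∫ t in (0 : ℝ)..1, inner ℝ (gradient φ (x + t • z)) z := by
  have hg := continuous_gradient hφ
  rw [intervalIntegral.integral_eq_sub_of_hasDerivAt (f := fun t : ℝ => φ (x + t • z))]
  · simp
  · intro t _
    rw [inner_gradient_left]
    have h1 : HasDerivAt (fun t : ℝ => x + t • z) z t := by
      simpa using ((hasDerivAt_id t).smul_const z).const_add x
    exact ((hφ.differentiable (by norm_num)) (x + t • z)).hasFDerivAt.comp_hasDerivAt t h1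
  · apply Continuous.intervalIntegrable
    fun_prop

/-- Translating a `C¹` function by `z` moves it in `L²` by at most `‖z‖` times the norm of its
gradient. -/
theorem lintegral_translate_sub_sq_le {φ : Euc d → ℝ} (hφ : ContDiff ℝ 1 φ) (z : Euc d) :
    ∫⁻ x, ‖φ (x + z) - φ x‖ₑ ^ 2 ≤ ‖z‖ₑ ^ 2 * ∫⁻ x, ‖gradient φ x‖ₑ ^ 2 := by
  have hg := continuous_gradient hφ
  have key : ∀ x, ‖φ (x + z) - φ x‖ₑ ^ 2 ≤
      ∫⁻ t in Set.Ioc (0 : ℝ) 1, ‖z‖ₑ ^ 2 * ‖gradient φ (x + t • z)‖ₑ ^ 2 := by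
    intro x
    have h1 : ‖φ (x + z) - φ x‖ₑ ≤
        ∫⁻ t in Set.Ioc (0 : ℝ) 1, ‖z‖ₑ * ‖gradient φ (x + t • z)‖ₑ := by
      rw [sub_eq_integral_gradient hφ, intervalIntegral.integral_of_le zero_le_one]
      refine (enorm_integral_le_lintegral_enorm _).trans (lintegral_mono fun t => ?_)
      rw [mul_comm]
      simp only [← ofReal_norm, ← ENNReal.ofReal_mul (norm_nonneg _)]
      exact ENNReal.ofReal_le_ofReal (norm_inner_le_norm _ _)
    calc _ ≤ (∫⁻ t in Set.Ioc (0 : ℝ) 1, ‖z‖ₑ * ‖gradient φ (x + t • z)‖ₑ) ^ 2 := by gcongr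
      _ ≤ _ := lintegral_sq_le _ (by fun_prop)
      _ = _ := by simp [mul_pow]
  calc ∫⁻ x, ‖φ (x + z) - φ x‖ₑ ^ 2
      ≤ ∫⁻ x, ∫⁻ t in Set.Ioc (0 : ℝ) 1, ‖z‖ₑ ^ 2 * ‖gradient φ (x + t • z)‖ₑ ^ 2 :=
        lintegral_mono key
    _ = ∫⁻ t in Set.Ioc (0 : ℝ) 1, ∫⁻ x, ‖z‖ₑ ^ 2 * ‖gradient φ (x + t • z)‖ₑ ^ 2 := by
        refine lintegral_lintegral_swap (Measurable.aemeasurable ?_)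
        simp only [Function.uncurry_def]
        have : Continuous fun p : Euc d × ℝ => gradient φ (p.1 + p.2 • z) := by fun_prop
        exact (this.enorm.measurable.pow_const 2).const_mul _
    _ = ∫⁻ t in Set.Ioc (0 : ℝ) 1, ‖z‖ₑ ^ 2 * ∫⁻ x, ‖gradient φ x‖ₑ ^ 2 := by
        refine lintegral_congr fun t => ?_
        have : Continuous fun x : Euc d => gradient φ (x + t • z) := by fun_prop
        rw [lintegral_const_mul _ (this.enorm.measurable.pow_const 2),
          lintegral_add_right_eq_self (fun x => ‖gradient φ x‖ₑ ^ 2)]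
    _ = _ := by simp

/-! ### Averages over grid cubes. -/

/-- The half-open cube of side `h` with index `k` of the grid of size `h`. -/
def gridCube (h : ℝ) (k : Fin d → ℤ) : Set (Euc d) := {x | ∀ i, ⌊x i / h⌋ = k i}

theorem volume_box (a b : Fin d → ℝ) :
    volume {x : Euc d | ∀ i, x i ∈ Set.Ico (a i) (b i)} = ∏ i, ENNReal.ofReal (b i - a i) := by
  rw [← Real.volume_pi_Ico, ← (PiLp.volume_preserving_ofLp (Fin d)).measure_preimage
    (MeasurableSet.univ_pi fun i => measurableSet_Ico).nullMeasurableSet]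
  congr 1
  ext x
  simp

theorem measurableSet_gridCube (h : ℝ) (k : Fin d → ℤ) : MeasurableSet (gridCube h k) := by
  have : gridCube h k = ⋂ i, (fun x : Euc d => ⌊x i / h⌋) ⁻¹' {k i} := by
    ext x; simp [gridCube]
  rw [this]
  refine MeasurableSet.iInter fun i => ?_
  have : Measurable fun x : Euc d => ⌊x i / h⌋ :=
    Int.measurable_floor.comp (by fun_prop)
  exact this (measurableSet_singleton _)

theorem volume_gridCube {h : ℝ} (hh : 0 < h) (k : Fin d → ℤ) :
    volume (gridCube h k) = ENNReal.ofReal (h ^ d) := by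
  have : gridCube h k = {x : Euc d | ∀ i, x i ∈ Set.Ico (k i * h) (k i * h + h)} := by
    ext x
    simp only [gridCube, Set.mem_ofPred_eq, Int.floor_eq_iff, Set.mem_Ico, le_div_iff₀ hh,
      div_lt_iff₀ hh, add_mul, one_mul]
  rw [this, volume_box]
  simp [ENNReal.ofReal_pow hh.le]

variable {d : ℕ}

/-- The half-open cube of side `2h` around the origin. -/
def centeredCube (d : ℕ) (h : ℝ) : Set (Euc d) := {z | ∀ i, z i ∈ Set.Ico (-h) h}

theorem volume_centeredCube {h : ℝ} (hh : 0 < h) :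
    volume (centeredCube d h) = ENNReal.ofReal (2 ^ d * h ^ d) := by
  rw [centeredCube, volume_box]
  rw [Finset.prod_const, Finset.card_univ, Fintype.card_fin, ← ENNReal.ofReal_pow (by linarith),
    ← mul_pow]
  ring_nf

theorem measurableSet_centeredCube (h : ℝ) : MeasurableSet (centeredCube d h) := by
  have : centeredCube d h = ⋂ i, (fun x : Euc d => x i) ⁻¹' Set.Ico (-h) h := by
    ext x; simp [centeredCube]
  rw [this]
  exact MeasurableSet.iInter fun i => measurableSet_Ico.preimage (by fun_prop)

theorem enorm_sq_le_of_mem_centeredCube {h : ℝ} {z : Euc d} (hz : z ∈ centeredCube d h) :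
    ‖z‖ₑ ^ 2 ≤ ENNReal.ofReal (d * h ^ 2) := by
  rw [← ofReal_norm, ← ENNReal.ofReal_pow (norm_nonneg _), EuclideanSpace.norm_sq_eq]
  refine ENNReal.ofReal_le_ofReal ?_
  calc ∑ i, ‖z i‖ ^ 2 ≤ ∑ _i : Fin d, h ^ 2 := by
        refine Finset.sum_le_sum fun i _ => ?_
        rw [Real.norm_eq_abs, sq_abs]
        have h1 := (hz i).1
        have h2 := (hz i).2
        nlinarith
    _ = d * h ^ 2 := by simp

theorem sub_mem_centeredCube {h : ℝ} (hh : 0 < h) {k : Fin d → ℤ} {x z : Euc d}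
    (hx : x ∈ gridCube h k) (hz : x + z ∈ gridCube h k) : z ∈ centeredCube d h := by
  intro i
  have h1 := Int.floor_eq_iff.1 (hx i)
  have h2 := Int.floor_eq_iff.1 (hz i)
  rw [le_div_iff₀ hh, div_lt_iff₀ hh] at h1 h2
  rw [PiLp.add_apply] at h2
  constructor <;> nlinarith

/-- The distance of `φ x` to the average of `φ` over the grid cube containing `x`. -/
theorem enorm_sub_average_sq_le {h : ℝ} (hh : 0 < h) {φ : Euc d → ℝ} (hφ : Continuous φ)
    (hi : Integrable φ) {k : Fin d → ℤ} {x : Euc d} (hx : x ∈ gridCube h k) :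
    ‖φ x - (h ^ d)⁻¹ * ∫ y in gridCube h k, φ y‖ₑ ^ 2 ≤
      ENNReal.ofReal ((h ^ d)⁻¹) * ∫⁻ z in centeredCube d h, ‖φ (x + z) - φ x‖ₑ ^ 2 := by
  have hM : 0 < h ^ d := by positivity
  have hvol := volume_gridCube hh k
  have h1 : φ x - (h ^ d)⁻¹ * ∫ y in gridCube h k, φ y =
      (h ^ d)⁻¹ * ∫ y in gridCube h k, (φ x - φ y) := by
    have hfin : IsFiniteMeasure (volume.restrict (gridCube h k)) :=
      ⟨by simp [hvol]⟩
    rw [integral_sub (integrable_const _) hi.integrableOn, setIntegral_const, measureReal_def, hvol,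
      ENNReal.toReal_ofReal hM.le, smul_eq_mul]
    field_simp
  have h2 : ‖∫ y in gridCube h k, (φ x - φ y)‖ₑ ^ 2 ≤
      ENNReal.ofReal (h ^ d) * ∫⁻ y in gridCube h k, ‖φ y - φ x‖ₑ ^ 2 := by
    have hme : Continuous fun y => ‖φ x - φ y‖ₑ := by fun_prop
    calc ‖∫ y in gridCube h k, (φ x - φ y)‖ₑ ^ 2
        ≤ (∫⁻ y in gridCube h k, ‖φ x - φ y‖ₑ) ^ 2 := by
          gcongr; exact enorm_integral_le_lintegral_enorm _
      _ ≤ _ := lintegral_sq_le _ hme.measurable.aemeasurable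
      _ = _ := by
          rw [Measure.restrict_apply_univ, hvol]
          simp_rw [enorm_sub_rev]
  have h3 : ∫⁻ y in gridCube h k, ‖φ y - φ x‖ₑ ^ 2 ≤
      ∫⁻ z in centeredCube d h, ‖φ (x + z) - φ x‖ₑ ^ 2 := by
    rw [← lintegral_indicator (measurableSet_gridCube h k),
      ← lintegral_indicator (measurableSet_centeredCube h),
      ← lintegral_add_left_eq_self _ x]
    refine lintegral_mono fun z => ?_
    by_cases hz : x + z ∈ gridCube h k
    · rw [Set.indicator_of_mem hz, Set.indicator_of_mem (sub_mem_centeredCube hh hx hz)]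
    · rw [Set.indicator_of_notMem hz]
      exact zero_le
  rw [h1, enorm_mul, mul_pow]
  calc _ ≤ ‖(h ^ d)⁻¹‖ₑ ^ 2 * (ENNReal.ofReal (h ^ d) *
        ∫⁻ z in centeredCube d h, ‖φ (x + z) - φ x‖ₑ ^ 2) := by
        gcongr; exact h2.trans (by gcongr)
    _ = _ := by
        rw [← mul_assoc, Real.enorm_eq_ofReal (by positivity), ← ENNReal.ofReal_pow (by positivity),
          ← ENNReal.ofReal_mul (by positivity)]
        congr 2
        field_simp

/-- Approximation of a `C¹` function by its averages over grid cubes. -/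
theorem lintegral_sub_average_sq_le {h : ℝ} (hh : 0 < h) {φ : Euc d → ℝ} (hφ : ContDiff ℝ 1 φ)
    (hi : Integrable φ) :
    ∫⁻ x, ‖φ x - (h ^ d)⁻¹ * ∫ y in gridCube h (fun i => ⌊x i / h⌋), φ y‖ₑ ^ 2 ≤
      ENNReal.ofReal (2 ^ d * d * h ^ 2) * ∫⁻ x, ‖gradient φ x‖ₑ ^ 2 := by
  have hM : 0 < h ^ d := by positivity
  have hφc := hφ.continuous
  have hcont : Continuous fun p : Euc d × Euc d => ‖φ (p.1 + p.2) - φ p.1‖ₑ := by fun_prop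
  -- Averaging the translation estimate over the centred cube, where ‖z‖² ≤ d h², gives h⁻ᵈ · (2h)ᵈ
  -- · d h² = 2ᵈ d h².
  calc _ ≤ ∫⁻ x, ENNReal.ofReal ((h ^ d)⁻¹) *
          ∫⁻ z in centeredCube d h, ‖φ (x + z) - φ x‖ₑ ^ 2 :=
        lintegral_mono fun x => enorm_sub_average_sq_le hh hφc hi fun _ => rfl
    _ = ENNReal.ofReal ((h ^ d)⁻¹) * ∫⁻ x, ∫⁻ z in centeredCube d h, ‖φ (x + z) - φ x‖ₑ ^ 2 :=
        lintegral_const_mul' _ _ ENNReal.ofReal_ne_top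
    _ = ENNReal.ofReal ((h ^ d)⁻¹) * ∫⁻ z in centeredCube d h, ∫⁻ x, ‖φ (x + z) - φ x‖ₑ ^ 2 := by
        rw [lintegral_lintegral_swap]
        exact (hcont.measurable.pow_const 2).aemeasurable
    _ ≤ ENNReal.ofReal ((h ^ d)⁻¹) * ∫⁻ _z in centeredCube d h,
          ENNReal.ofReal (d * h ^ 2) * ∫⁻ x, ‖gradient φ x‖ₑ ^ 2 := by
        gcongr 1
        refine setLIntegral_mono (by fun_prop) fun z hz => ?_
        refine (lintegral_translate_sub_sq_le hφ z).trans ?_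
        gcongr
        exact enorm_sq_le_of_mem_centeredCube hz
    _ = _ := by
        rw [setLIntegral_const, volume_centeredCube hh, mul_comm _ (ENNReal.ofReal (2 ^ d * h ^ d)),
          ← mul_assoc, ← mul_assoc, ← ENNReal.ofReal_mul (by positivity),
          ← ENNReal.ofReal_mul (by positivity)]
        congr 2
        field_simp

/-! ### Test functions and the Poincaré inequality. -/

noncomputable section

variable {d : ℕ} {Ω : Set (Euc d)}

theorem IsTest.eq_zero {φ : Euc d → ℝ} (hφ : IsTest Ω φ) {x : Euc d} (hx : x ∉ Ω) : φ x = 0 :=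
  image_eq_zero_of_notMem_tsupport fun h => hx (hφ.supp h)

theorem IsTest.gradient_eq_zero {φ : Euc d → ℝ} (hφ : IsTest Ω φ) {x : Euc d} (hx : x ∉ Ω) :
    gradient φ x = 0 := by
  have : fderiv ℝ φ x = 0 := by
    by_contra h
    exact hx (hφ.supp (support_fderiv_subset ℝ h))
  simp [gradient, this]

theorem IsTest.contDiff_one {φ : Euc d → ℝ} (hφ : IsTest Ω φ) : ContDiff ℝ 1 φ :=
  hφ.smooth.of_le (by exact_mod_cast le_top)

theorem IsTest.integrable {φ : Euc d → ℝ} (hφ : IsTest Ω φ) : Integrable φ :=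
  hφ.smooth.continuous.integrable_of_hasCompactSupport hφ.compact

theorem IsTest.lintegral_gradient {φ : Euc d → ℝ} (hΩ : IsOpen Ω) (hφ : IsTest Ω φ) :
    ∫⁻ x, ‖gradient φ x‖ₑ ^ 2 = ∫⁻ x in Ω, ‖gradient φ x‖ₑ ^ 2 := by
  rw [← lintegral_indicator hΩ.measurableSet]
  refine lintegral_congr fun x => ?_
  by_cases hx : x ∈ Ω
  · rw [Set.indicator_of_mem hx]
  · rw [Set.indicator_of_notMem hx, hφ.gradient_eq_zero hx]; simp

theorem norm_sq_le_of_enorm_sq_le {E F : Type*} [NormedAddCommGroup E] [NormedAddCommGroup F]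
    {x : E} {y : F} {c : ℝ} (hc : 0 ≤ c) (h : ‖x‖ₑ ^ 2 ≤ ENNReal.ofReal c * ‖y‖ₑ ^ 2) :
    ‖x‖ ^ 2 ≤ c * ‖y‖ ^ 2 := by
  rw [← ofReal_norm, ← ofReal_norm, ← ENNReal.ofReal_pow (norm_nonneg _),
    ← ENNReal.ofReal_pow (norm_nonneg _), ← ENNReal.ofReal_mul hc] at h
  exact (ENNReal.ofReal_le_ofReal_iff (by positivity)).1 h

/-- A quadratic estimate by the gradient extends from test functions to `H_0^1`. -/
theorem norm_sq_le_of_testGraph (F : Lp ℝ 2 (volume.restrict Ω) →L[ℝ] Lp ℝ 2 (volume.restrict Ω))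
    (c : ℝ) (h : ∀ p ∈ testGraph Ω, ‖F p.fst‖ ^ 2 ≤ c * ‖p.snd‖ ^ 2) (u : H10 Ω) :
    ‖F u.1.fst‖ ^ 2 ≤ c * ‖u.1.snd‖ ^ 2 := by
  have hcl : IsClosed {p : L2Pair Ω | ‖F p.fst‖ ^ 2 ≤ c * ‖p.snd‖ ^ 2} := by
    have h1 : Continuous fun p : L2Pair Ω => p.fst := (WithLp.fstL 2 ℝ _ _).continuous
    have h2 : Continuous fun p : L2Pair Ω => p.snd := (WithLp.sndL 2 ℝ _ _).continuous
    exact isClosed_le (by fun_prop) (by fun_prop)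
  exact closure_minimal (fun p hp => h p hp) hcl u.2

theorem lintegral_gradient_eq_enorm (hΩ : IsOpen Ω) {p : L2Pair Ω} {φ : Euc d → ℝ}
    (hφ : IsTest Ω φ) (hp : p.snd =ᵐ[volume.restrict Ω] gradient φ) :
    ∫⁻ x, ‖gradient φ x‖ₑ ^ 2 = ‖p.snd‖ₑ ^ 2 := by
  rw [hφ.lintegral_gradient hΩ, enorm_sq_eq_lintegral]
  refine lintegral_congr_ae ?_
  filter_upwards [hp] with x hx
  rw [hx]

/-- **Poincaré inequality** on a bounded open set. -/
theorem exists_poincare (hd : 1 ≤ d) (hΩ : IsOpen Ω) (hb : Bornology.IsBounded Ω) :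
    ∃ C > 0, ∀ u : H10 Ω, ‖u.1.fst‖ ≤ C * ‖u.1.snd‖ := by
  obtain ⟨R, hR0, hR⟩ := hb.subset_ball_lt 0 0
  -- Ω lies in the ball of radius R, so a shift by 2R moves it off itself and φ(x + z) - φ(x) =
  -- -φ(x) on Ω. Such a `z` exists because d ≥ 1.
  obtain ⟨z, hz⟩ : ∃ z : Euc d, ‖z‖ = 2 * R :=
    ⟨EuclideanSpace.single ⟨0, hd⟩ (2 * R), by simp [abs_of_pos hR0]⟩
  have hzΩ : ∀ x ∈ Ω, x + z ∉ Ω := by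
    intro x hx hxz
    have h1 := hR hx
    have h2 := hR hxz
    rw [mem_ball_zero_iff] at h1 h2
    have h3 : ‖z‖ ≤ ‖x + z‖ + ‖x‖ := by
      simpa using norm_sub_le (x + z) x
    linarith
  refine ⟨2 * R, by positivity, fun u => ?_⟩
  have h : ‖u.1.fst‖ ^ 2 ≤ (2 * R) ^ 2 * ‖u.1.snd‖ ^ 2 := by
    refine norm_sq_le_of_testGraph (ContinuousLinearMap.id ℝ _) _ ?_ u
    rintro p ⟨φ, hφ, h1, h2⟩
    refine norm_sq_le_of_enorm_sq_le (by positivity) ?_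
    rw [ContinuousLinearMap.id_apply, ← lintegral_gradient_eq_enorm hΩ hφ h2,
      enorm_sq_eq_lintegral, ENNReal.ofReal_pow (by positivity), ← hz, ofReal_norm]
    refine le_trans ?_ (lintegral_translate_sub_sq_le hφ.contDiff_one z)
    refine le_trans (le_of_eq ?_) (setLIntegral_le_lintegral Ω _)
    refine lintegral_congr_ae ?_
    filter_upwards [h1, ae_restrict_mem hΩ.measurableSet] with x hx hxΩ
    rw [hx, hφ.eq_zero (hzΩ x hxΩ), zero_sub, enorm_neg]
  rw [← mul_pow] at h
  exact le_of_sq_le_sq h (by positivity)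

/-! ### Finite-rank approximation and Rellich's theorem. -/

theorem restrict_gridCube_ne_top {h : ℝ} (hh : 0 < h) (k : Fin d → ℤ) :
    (volume.restrict Ω) (gridCube h k) ≠ ⊤ :=
  ((Measure.restrict_apply_le _ _).trans_lt
    ((volume_gridCube hh k).trans_lt ENNReal.ofReal_lt_top)).ne

/-- The indicator functions of the grid cubes, as elements of `L²(Ω)`. -/
def cubeIndicator (Ω : Set (Euc d)) {h : ℝ} (hh : 0 < h) (k : Fin d → ℤ) :
    Lp ℝ 2 (volume.restrict Ω) :=
  indicatorConstLp 2 (measurableSet_gridCube h k) (restrict_gridCube_ne_top hh k) (1 : ℝ)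

/-- The averaging operator over finitely many grid cubes. -/
def averageOp (Ω : Set (Euc d)) {h : ℝ} (hh : 0 < h) (s : Finset (Fin d → ℤ)) :
    Lp ℝ 2 (volume.restrict Ω) →L[ℝ] Lp ℝ 2 (volume.restrict Ω) :=
  ∑ k ∈ s, (h ^ d)⁻¹ •
    (innerSL ℝ (cubeIndicator Ω hh k)).smulRight (cubeIndicator Ω hh k)

theorem isCompactOperator_averageOp {h : ℝ} (hh : 0 < h) (s : Finset (Fin d → ℤ)) :
    IsCompactOperator (averageOp Ω hh s) := by
  have : averageOp Ω hh s ∈ compactOperator (RingHom.id ℝ) (Lp ℝ 2 (volume.restrict Ω))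
      (Lp ℝ 2 (volume.restrict Ω)) := by
    rw [averageOp]
    refine Submodule.sum_mem _ fun k _ => Submodule.smul_mem _ _ ?_
    have h1 : IsCompactOperator (ContinuousLinearMap.toSpanSingleton ℝ (cubeIndicator Ω hh k)) :=
      isCompactOperator_of_locallyCompactSpace_rng _
    exact h1.comp_clm (innerSL ℝ (cubeIndicator Ω hh k))
  exact this

theorem averageOp_ae {h : ℝ} (hh : 0 < h) (s : Finset (Fin d → ℤ))
    (f : Lp ℝ 2 (volume.restrict Ω)) :
    ∀ᵐ x ∂volume.restrict Ω, averageOp Ω hh s f x =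
      ∑ k ∈ s, (gridCube h k).indicator
        (fun _ => (h ^ d)⁻¹ * ∫ y in gridCube h k, f y ∂volume.restrict Ω) x := by
  have happ : averageOp Ω hh s f = ∑ k ∈ s, ((h ^ d)⁻¹ *
      ∫ y in gridCube h k, f y ∂volume.restrict Ω) • cubeIndicator Ω hh k := by
    simp only [averageOp, sum_apply, smul_apply,
      ContinuousLinearMap.smulRight_apply, innerSL_apply_apply, smul_smul]
    refine Finset.sum_congr rfl fun k _ => ?_
    rw [cubeIndicator, L2.inner_indicatorConstLp_one]
  rw [happ]
  clear happ
  induction s using Finset.induction_on with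
  | empty =>
    simp only [Finset.sum_empty]
    exact Lp.coeFn_zero ℝ 2 _
  | insert k s hk ih =>
    simp only [Finset.sum_insert hk]
    filter_upwards [ih, Lp.coeFn_add (((h ^ d)⁻¹ *
      ∫ y in gridCube h k, f y ∂volume.restrict Ω) • cubeIndicator Ω hh k)
      (∑ k ∈ s, ((h ^ d)⁻¹ *
      ∫ y in gridCube h k, f y ∂volume.restrict Ω) • cubeIndicator Ω hh k),
      Lp.coeFn_smul ((h ^ d)⁻¹ * ∫ y in gridCube h k, f y ∂volume.restrict Ω)
        (cubeIndicator Ω hh k),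
      indicatorConstLp_coeFn (p := 2) (hs := measurableSet_gridCube h k)
        (hμs := restrict_gridCube_ne_top (Ω := Ω) hh k) (c := (1 : ℝ))] with x h1 h2 h3 h4
    rw [h2, Pi.add_apply, h1, h3, Pi.smul_apply, cubeIndicator, h4]
    congr 1
    by_cases hx : x ∈ gridCube h k <;> simp [hx]

theorem exists_finset_gridCube (hb : Bornology.IsBounded Ω) {h : ℝ} (hh : 0 < h) :
    ∃ s : Finset (Fin d → ℤ), ∀ x ∈ Ω, (fun i => ⌊x i / h⌋) ∈ s := by
  obtain ⟨R, hR0, hR⟩ := hb.subset_ball_lt 0 0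
  refine ⟨Fintype.piFinset fun _ => Finset.Icc ⌊-R / h⌋ ⌊R / h⌋, fun x hx => ?_⟩
  rw [Fintype.mem_piFinset]
  intro i
  have h1 : |x i| ≤ R := by
    have h2 := hR hx
    rw [mem_ball_zero_iff] at h2
    exact (PiLp.norm_apply_le x i).trans h2.le
  rw [abs_le] at h1
  rw [Finset.mem_Icc]
  exact ⟨Int.floor_mono (by gcongr; exact h1.1), Int.floor_mono (by gcongr; exact h1.2)⟩

/-- Since `s` indexes every cube that meets Ω, each point of Ω sees exactly the average over its own
cube. Test functions vanish off Ω, so integrating over the part of a cube inside Ω or over the whole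
cube is the same, and the grid estimate applies. Density carries the bound to H₀¹. -/
theorem norm_sub_averageOp_sq_le (hΩ : IsOpen Ω) {h : ℝ} (hh : 0 < h)
    {s : Finset (Fin d → ℤ)} (hs : ∀ x ∈ Ω, (fun i => ⌊x i / h⌋) ∈ s) (u : H10 Ω) :
    ‖u.1.fst - averageOp Ω hh s u.1.fst‖ ^ 2 ≤ 2 ^ d * d * h ^ 2 * ‖u.1.snd‖ ^ 2 := by
  have key := norm_sq_le_of_testGraph (ContinuousLinearMap.id ℝ _ - averageOp Ω hh s)
    (2 ^ d * d * h ^ 2) ?_ u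
  · rwa [sub_apply, ContinuousLinearMap.id_apply] at key
  rintro p ⟨φ, hφ, h1, h2⟩
  refine norm_sq_le_of_enorm_sq_le (by positivity) ?_
  rw [← lintegral_gradient_eq_enorm hΩ hφ h2, enorm_sq_eq_lintegral]
  refine le_trans ?_ (lintegral_sub_average_sq_le hh hφ.contDiff_one hφ.integrable)
  refine le_trans (le_of_eq ?_) (setLIntegral_le_lintegral Ω _)
  refine lintegral_congr_ae ?_
  filter_upwards [h1, ae_restrict_mem hΩ.measurableSet, averageOp_ae hh s p.fst,
    Lp.coeFn_sub p.fst (averageOp Ω hh s p.fst)] with x hx hxΩ hav hsub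
  rw [sub_apply, ContinuousLinearMap.id_apply, hsub, Pi.sub_apply, hav, hx,
    Finset.sum_eq_single (fun i => ⌊x i / h⌋)]
  · have hmem : x ∈ gridCube h (fun i => ⌊x i / h⌋) := fun _ => rfl
    rw [Set.indicator_of_mem hmem]
    have hint : ∫ y in gridCube h (fun i => ⌊x i / h⌋), p.fst y ∂volume.restrict Ω =
        ∫ y in gridCube h (fun i => ⌊x i / h⌋), φ y := by
      rw [setIntegral_congr_ae (g := φ) (measurableSet_gridCube h _)
        (by filter_upwards [h1] with y hy _ using hy),
        Measure.restrict_restrict (measurableSet_gridCube h _)]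
      exact (setIntegral_eq_of_subset_of_forall_sdiff_eq_zero (measurableSet_gridCube h _)
        Set.inter_subset_left fun y hy => hφ.eq_zero fun hyΩ => hy.2 ⟨hy.1, hyΩ⟩).symm
    rw [hint]
  · intro k _ hk
    refine Set.indicator_of_notMem (fun hxk => hk ?_) _
    funext i
    exact (hxk i).symm
  · exact fun hn => absurd (hs x hxΩ) hn

/-- The embedding `H_0^1(Ω) → L²(Ω)`. -/
def valL (Ω : Set (Euc d)) : H10 Ω →L[ℝ] Lp ℝ 2 (volume.restrict Ω) :=
  (WithLp.fstL 2 ℝ _ _).comp (H10 Ω).subtypeL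

/-- The weak gradient `H_0^1(Ω) → L²(Ω; ℝ^d)`. -/
def gradL (Ω : Set (Euc d)) : H10 Ω →L[ℝ] Lp (Euc d) 2 (volume.restrict Ω) :=
  (WithLp.sndL 2 ℝ _ _).comp (H10 Ω).subtypeL

/-- An operator that compact operators approximate at rate `1 / (n + 1)` is compact. -/
theorem isCompactOperator_of_norm_sub_le {V H : Type*} [NormedAddCommGroup V] [NormedSpace ℝ V]
    [NormedAddCommGroup H] [NormedSpace ℝ H] [CompleteSpace H] {C : ℝ} (T : V →L[ℝ] H)
    (S : ℕ → V →L[ℝ] H) (hC : 0 ≤ C) (hS : ∀ n, IsCompactOperator (S n))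
    (h : ∀ (n : ℕ) (u : V), ‖T u - S n u‖ ≤ C * (1 / ((n : ℝ) + 1)) * ‖u‖) :
    IsCompactOperator T := by
  refine isCompactOperator_of_tendsto (l := Filter.atTop) (F := S) ?_
    (Filter.Eventually.of_forall hS)
  rw [tendsto_iff_norm_sub_tendsto_zero]
  have hlim : Filter.Tendsto (fun n : ℕ => C * (1 / ((n : ℝ) + 1))) Filter.atTop (nhds 0) := by
    simpa using tendsto_one_div_add_atTop_nhds_zero_nat.const_mul C
  refine squeeze_zero (fun _ => norm_nonneg _) (fun n => ?_) hlim
  refine ContinuousLinearMap.opNorm_le_bound _ (by positivity) fun u => ?_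
  rw [sub_apply, norm_sub_rev]
  exact h n u

/-- **Rellich's theorem**: the embedding `H_0^1(Ω) → L²(Ω)` is compact for a bounded open `Ω`. -/
theorem isCompactOperator_valL (hΩ : IsOpen Ω) (hb : Bornology.IsBounded Ω) :
    IsCompactOperator (valL Ω) := by
  have hpos : ∀ n : ℕ, 0 < 1 / ((n : ℝ) + 1) := fun n => by positivity
  choose s hs using fun n : ℕ => exists_finset_gridCube hb (hpos n)
  refine isCompactOperator_of_norm_sub_le (C := Real.sqrt (2 ^ d * d)) (valL Ω)
    (fun n : ℕ => (averageOp Ω (hpos n) (s n)).comp (valL Ω)) (Real.sqrt_nonneg _)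
    (fun n => (isCompactOperator_averageOp _ _).comp_clm _) fun n u => ?_
  have h1 := norm_sub_averageOp_sq_le hΩ (hpos n) (hs n) u
  have h2 : ‖u.1.snd‖ ≤ ‖u‖ := by
    have := WithLp.prod_norm_sq_eq_of_L2 u.1
    refine le_of_sq_le_sq (?_ : ‖u.1.snd‖ ^ 2 ≤ ‖u.1‖ ^ 2) (norm_nonneg _)
    rw [this]; nlinarith [sq_nonneg ‖u.1.fst‖]
  refine le_of_sq_le_sq ?_ (by positivity)
  refine le_trans h1 ?_
  rw [mul_pow, mul_pow, Real.sq_sqrt (by positivity)]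
  gcongr

end

/-! ### Families close to an orthonormal family. -/

section Perturbation

variable {H : Type*} [NormedAddCommGroup H] [InnerProductSpace ℝ H] {m : ℕ} {p q : Fin m → H}
  {η : ℝ}

/-- Combinations of a family `q` close to an orthonormal family `p` are close to the same
combinations of `p`. -/
theorem norm_sum_smul_sub_le (hp : Orthonormal ℝ p) (hpq : ∀ i, ‖p i - q i‖ ≤ η)
    (hη : m * η ≤ 1 / 2) (c : Fin m → ℝ) :
    ‖∑ i, c i • (p i - q i)‖ ≤ 2 * m * η * ‖∑ i, c i • q i‖ ∧
      ‖∑ i, c i • p i‖ ≤ 2 * ‖∑ i, c i • q i‖ := by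
  have hc : ∀ i, |c i| ≤ ‖∑ i, c i • p i‖ := by
    intro i
    have h1 : inner ℝ (p i) (∑ i, c i • p i) = c i := hp.inner_right_fintype c i
    have h2 := abs_real_inner_le_norm (p i) (∑ i, c i • p i)
    rwa [h1, hp.1 i, one_mul] at h2
  have h1 : ‖∑ i, c i • (p i - q i)‖ ≤ m * η * ‖∑ i, c i • p i‖ := by
    calc ‖∑ i, c i • (p i - q i)‖ ≤ ∑ i, ‖c i • (p i - q i)‖ := norm_sum_le _ _
      _ ≤ ∑ _i : Fin m, ‖∑ i, c i • p i‖ * η := by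
          refine Finset.sum_le_sum fun i _ => ?_
          rw [norm_smul, Real.norm_eq_abs]
          exact mul_le_mul (hc i) (hpq i) (norm_nonneg _) (norm_nonneg _)
      _ = m * η * ‖∑ i, c i • p i‖ := by simp; ring
  have h2 : ‖∑ i, c i • p i‖ ≤ ‖∑ i, c i • (p i - q i)‖ + ‖∑ i, c i • q i‖ := by
    refine le_trans (le_of_eq ?_) (norm_add_le _ _)
    simp [smul_sub]
  -- The hypothesis m η ≤ 1/2 lets this term be absorbed on the left, at the price of the factor 2.
  have h3 : m * η * ‖∑ i, c i • p i‖ ≤ 1 / 2 * ‖∑ i, c i • p i‖ := by gcongr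
  have h4 : ‖∑ i, c i • p i‖ ≤ 2 * ‖∑ i, c i • q i‖ := by linarith
  refine ⟨?_, h4⟩
  rcases Nat.eq_zero_or_pos m with rfl | hm
  · simp
  · have hη0 : 0 ≤ η := (norm_nonneg _).trans (hpq ⟨0, hm⟩)
    calc _ ≤ m * η * (2 * ‖∑ i, c i • q i‖) := h1.trans (by gcongr)
      _ = _ := by ring

theorem linearIndependent_of_near_orthonormal (hp : Orthonormal ℝ p)
    (hpq : ∀ i, ‖p i - q i‖ ≤ η) (hη : m * η ≤ 1 / 2) : LinearIndependent ℝ q := by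
  rw [Fintype.linearIndependent_iff]
  intro c hc
  have h := (norm_sum_smul_sub_le hp hpq hη c).2
  rw [hc, norm_zero, mul_zero] at h
  exact Fintype.linearIndependent_iff.1 hp.linearIndependent c (norm_le_zero_iff.1 h)

/-- The bounds needed for the perturbation argument hold for small `δ`. -/
theorem exists_small_delta (m : ℕ) {lam Λ C : ℝ} (h0 : 0 ≤ lam) (h : lam < Λ) :
    ∃ δ > 0, m * (C * δ) ≤ 1 / 2 ∧
      (Real.sqrt lam * (1 + C * δ) + δ) ^ 2 < Λ * (1 - (2 * m * (C * δ)) ^ 2) := by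
  -- At δ = 0 the two inequalities read 0 < 1/2 and lam < Λ; both persist by continuity.
  have h1 : ∀ᶠ δ in nhds (0 : ℝ), (m : ℝ) * (C * δ) < 1 / 2 :=
    ContinuousAt.eventually_lt (by fun_prop) continuousAt_const (by norm_num)
  have h2 : ∀ᶠ δ in nhds (0 : ℝ),
      (Real.sqrt lam * (1 + C * δ) + δ) ^ 2 < Λ * (1 - (2 * m * (C * δ)) ^ 2) :=
    ContinuousAt.eventually_lt (by fun_prop) (by fun_prop) (by simpa [Real.sq_sqrt h0] using h)
  obtain ⟨ε, hε, hb⟩ := Metric.eventually_nhds_iff.1 (h1.and h2)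
  have h3 := hb (y := ε / 2) (by simp [abs_of_pos hε, hε])
  exact ⟨ε / 2, by positivity, h3.1.le, h3.2⟩

end Perturbation

/-! ### Stability of the gap and the abstract saddle-point problem. -/

section Saddle

variable {V H G : Type*} [NormedAddCommGroup V] [InnerProductSpace ℝ V]
  [NormedAddCommGroup H] [InnerProductSpace ℝ H]
  [NormedAddCommGroup G] [InnerProductSpace ℝ G] {m : ℕ} (ι : V →L[ℝ] H) (g : V →L[ℝ] G)

/-- A spectral gap above the eigenvectors `w i` persists on the complement of nearby vectors
`u i`. -/
theorem gap_of_near {u w : Fin m → V} {t : Fin m → ℝ} {η Λ : ℝ} (hΛ : 0 ≤ Λ)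
    (hw : ∀ i v, inner ℝ (g (w i)) (g v) = t i * inner ℝ (ι (w i)) (ι v))
    (hu : Orthonormal ℝ fun i => ι (u i)) (huw : ∀ i, ‖ι (u i) - ι (w i)‖ ≤ η)
    (hη : m * η ≤ 1 / 2)
    (hgap : ∀ z, (∀ i, inner ℝ (ι (w i)) (ι z) = 0) → Λ * ‖ι z‖ ^ 2 ≤ ‖g z‖ ^ 2)
    {v : V} (hv : ∀ i, inner ℝ (ι (u i)) (ι v) = 0) :
    Λ * (1 - (2 * m * η) ^ 2) * ‖ι v‖ ^ 2 ≤ ‖g v‖ ^ 2 := by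
  obtain ⟨c, hc⟩ := exists_sub_sum_orthogonal ι.toLinearMap w v
  set e := ∑ k, c k • w k with he
  set z := v - e with hz
  have hc' : ∀ i, inner ℝ (ι (w i)) (ι z) = 0 := hc
  have hve : v = e + z := by rw [hz]; abel
  have hez : inner ℝ (ι e) (ι z) = 0 := by
    rw [he, map_sum, sum_inner]
    refine Finset.sum_eq_zero fun i _ => ?_
    rw [map_smul, real_inner_smul_left, hc', mul_zero]
  have hgez : inner ℝ (g e) (g z) = 0 := by
    rw [he, map_sum, sum_inner]
    refine Finset.sum_eq_zero fun i _ => ?_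
    rw [map_smul, real_inner_smul_left, hw, hc', mul_zero, mul_zero]
  have h1 : ‖ι v‖ ^ 2 = ‖ι e‖ ^ 2 + ‖ι z‖ ^ 2 := by
    rw [hve, map_add, norm_add_sq_real, hez]; ring
  have h2 : ‖g v‖ ^ 2 = ‖g e‖ ^ 2 + ‖g z‖ ^ 2 := by
    rw [hve, map_add, norm_add_sq_real, hgez]; ring
  have hιe : ι e = ∑ i, c i • ι (w i) := by simp [he]
  have hbd := (norm_sum_smul_sub_le hu huw hη c).1
  rw [← hιe] at hbd
  have hev : inner ℝ (ι e) (ι v) = ‖ι e‖ ^ 2 := by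
    rw [hve, map_add, inner_add_right, hez, real_inner_self_eq_norm_sq, add_zero]
  -- As `v` is orthogonal to every `u i`, pairing it with `e` sees only the differences `u i - w i`.
  -- Hence the component `e` of `v` along the `w i` is small in H.
  have hev' : inner ℝ (∑ i, c i • (ι (u i) - ι (w i))) (ι v) = -‖ι e‖ ^ 2 := by
    rw [← hev, hιe, sum_inner, sum_inner, ← Finset.sum_neg_distrib]
    refine Finset.sum_congr rfl fun i _ => ?_
    rw [real_inner_smul_left, real_inner_smul_left, inner_sub_left, hv]
    ring
  have h3 : ‖ι e‖ ^ 2 ≤ 2 * m * η * ‖ι e‖ * ‖ι v‖ := by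
    have h := abs_real_inner_le_norm (∑ i, c i • (ι (u i) - ι (w i))) (ι v)
    rw [hev', abs_neg, abs_of_nonneg (sq_nonneg _)] at h
    exact h.trans (by gcongr)
  have h4 : ‖ι e‖ ^ 2 ≤ (2 * m * η) ^ 2 * ‖ι v‖ ^ 2 := by
    rcases (norm_nonneg (ι e)).eq_or_lt with h0 | h0
    · rw [← h0]
      have : 0 ≤ (2 * m * η) ^ 2 * ‖ι v‖ ^ 2 := by positivity
      simpa using this
    · have h5 : ‖ι e‖ ≤ 2 * m * η * ‖ι v‖ := by
        refine le_of_mul_le_mul_left ?_ h0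
        calc _ = ‖ι e‖ ^ 2 := by ring
          _ ≤ _ := h3
          _ = _ := by ring
      rw [← mul_pow]
      gcongr
  calc Λ * (1 - (2 * m * η) ^ 2) * ‖ι v‖ ^ 2
      = Λ * (‖ι v‖ ^ 2 - (2 * m * η) ^ 2 * ‖ι v‖ ^ 2) := by ring
    _ ≤ Λ * ‖ι z‖ ^ 2 := by gcongr; linarith
    _ ≤ ‖g z‖ ^ 2 := hgap z hc'
    _ ≤ ‖g v‖ ^ 2 := by rw [h2]; nlinarith [sq_nonneg ‖g e‖]

/-- Triangle inequalities through `w`: ‖ι w‖ ≤ 1 + Cδ, ‖g w‖ = √t ‖ι w‖ and ‖g u‖ ≤ ‖g w‖ + δ. Since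
‖ι u‖ = 1, this bounds the Rayleigh quotient of `u`. -/
theorem norm_sq_le_of_near_eigenvector {u w : V} {t lam C δ : ℝ} (ht0 : 0 ≤ t) (ht : t ≤ lam)
    (hw : ‖g w‖ ^ 2 = t * ‖ι w‖ ^ 2) (hu : ‖ι u‖ = 1) (h1 : ‖ι u - ι w‖ ≤ C * δ)
    (h2 : ‖g u - g w‖ ≤ δ) :
    ‖g u‖ ^ 2 ≤ (Real.sqrt lam * (1 + C * δ) + δ) ^ 2 := by
  have h3 : ‖ι w‖ ≤ 1 + C * δ := by
    have := norm_sub_norm_le (ι w) (ι u)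
    rw [norm_sub_rev, hu] at this
    linarith
  have h4 : ‖g w‖ = Real.sqrt t * ‖ι w‖ := by
    rw [← Real.sqrt_sq (norm_nonneg (g w)), hw, Real.sqrt_mul ht0, Real.sqrt_sq (norm_nonneg _)]
  have h5 : ‖g u‖ ≤ Real.sqrt lam * (1 + C * δ) + δ := by
    have h6 := norm_sub_norm_le (g u) (g w)
    have h7 : ‖g w‖ ≤ Real.sqrt lam * (1 + C * δ) := by
      rw [h4]
      gcongr
    linarith
  gcongr

/-- Unique solvability of the saddle-point problem with the form `⟪g u, g v⟫ - μ ⟪ι u, ι v⟫`,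
coercive on the complement of the vectors `u i`. -/
theorem existsUnique_saddle [CompleteSpace V]
    (hin : ∀ u v : V, inner ℝ u v = inner ℝ (ι u) (ι v) + inner ℝ (g u) (g v))
    {C : ℝ} (hC : ∀ v, ‖ι v‖ ≤ C * ‖g v‖) {u : Fin m → V}
    (hu : Orthonormal ℝ fun i => ι (u i)) {μ α : ℝ} (hα : 0 < α)
    (hco : ∀ v, (∀ i, inner ℝ (ι (u i)) (ι v) = 0) →
      α * ‖g v‖ ^ 2 ≤ ‖g v‖ ^ 2 - μ * ‖ι v‖ ^ 2)
    (f : V →L[ℝ] ℝ) (r : Fin m → ℝ) :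
    ∃! p : (Fin m → ℝ) × V,
      (∀ v, inner ℝ (g p.2) (g v) - μ * inner ℝ (ι p.2) (ι v) -
        ∑ i, p.1 i * inner ℝ (ι (u i)) (ι v) = f v) ∧
      ∀ i, inner ℝ (ι (u i)) (ι p.2) = r i := by
  have hsq : ∀ v : V, ‖v‖ ^ 2 = ‖ι v‖ ^ 2 + ‖g v‖ ^ 2 := fun v => by
    have := hin v v
    simpa only [real_inner_self_eq_norm_sq] using this
  have hsq' : ∀ v : V, ‖v‖ ^ 2 ≤ (C ^ 2 + 1) * ‖g v‖ ^ 2 := fun v => by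
    have h : ‖ι v‖ ^ 2 ≤ (C * ‖g v‖) ^ 2 := by
      gcongr; exact hC v
    rw [hsq]; linarith
  have hite : ∀ i j, inner ℝ (ι (u i)) (ι (u j)) = if i = j then (1 : ℝ) else 0 :=
    orthonormal_iff_ite.1 hu
  have hcomb : ∀ (c : Fin m → ℝ) i, inner ℝ (ι (u i)) (ι (∑ k, c k • u k)) = c i := by
    intro c i
    have h := hu.inner_right_fintype c i
    simpa using h
  let Z : Submodule ℝ V := ⨅ i, ((innerSL ℝ (ι (u i))).comp ι).ker
  have hmem : ∀ v, v ∈ Z ↔ ∀ i, inner ℝ (ι (u i)) (ι v) = 0 := fun v => by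
    simp [Z, Submodule.mem_iInf]
  have hZc : IsClosed (Z : Set V) := by
    have : (Z : Set V) = ⋂ i, {v | inner ℝ (ι (u i)) (ι v) = 0} := by
      ext v; simp only [SetLike.mem_coe, hmem, Set.mem_iInter]; rfl
    rw [this]
    exact isClosed_iInter fun i => isClosed_eq (by fun_prop) continuous_const
  have : CompleteSpace Z := hZc.completeSpace_coe
  let A : V →L[ℝ] V →L[ℝ] ℝ :=
    (innerSL ℝ).bilinearComp g g - μ • (innerSL ℝ).bilinearComp ι ι
  have hA : ∀ x y, A x y = inner ℝ (g x) (g y) - μ * inner ℝ (ι x) (ι y) := fun x y => rfl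
  let B : Z →L[ℝ] Z →L[ℝ] ℝ := A.bilinearComp Z.subtypeL Z.subtypeL
  have hB : ∀ x y : Z, B x y = A x y := fun x y => rfl
  have hBco : IsCoercive B := by
    -- The bound ‖v‖² ≤ (C² + 1)‖g v‖² converts coercivity in ‖g v‖ to the norm of `V`.
    refine ⟨α / (C ^ 2 + 1), by positivity, fun v => ?_⟩
    have h1 := hco v ((hmem v).1 v.2)
    have h2 := hsq' v
    rw [hB, hA, real_inner_self_eq_norm_sq, real_inner_self_eq_norm_sq]
    refine le_trans ?_ h1
    rw [div_mul_eq_mul_div, div_mul_eq_mul_div, div_le_iff₀ (by positivity)]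
    have h3 : ‖v‖ = ‖(v : V)‖ := rfl
    rw [h3]
    nlinarith
  -- By orthonormality `u₁` meets the constraints, so the correction `z` can be sought in `Z` by
  -- Lax–Milgram.
  set u₁ := ∑ k, r k • u k with hu₁
  obtain ⟨z, hz⟩ : ∃ z : Z, ∀ v : Z, A z v = f v - A u₁ v := by
    let F : Z →L[ℝ] ℝ := (f - A u₁).comp Z.subtypeL
    refine ⟨hBco.continuousLinearEquivOfBilin.symm ((InnerProductSpace.toDual ℝ Z).symm F),
      fun v => ?_⟩
    rw [← hB, ← hBco.continuousLinearEquivOfBilin_apply,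
      ContinuousLinearEquiv.apply_symm_apply, InnerProductSpace.toDual_symm_apply]
    rfl
  set s := (z : V) + u₁ with hs
  have hsr : ∀ i, inner ℝ (ι (u i)) (ι s) = r i := by
    intro i
    rw [hs, map_add, inner_add_right, (hmem z).1 z.2, hcomb, zero_add]
  -- The multipliers are forced by testing with `u i`. For a general `v`, subtract its combination
  -- `v₁` of the `u k` to land in `Z`.
  refine ⟨(fun i => A s (u i) - f (u i), s), ⟨fun v => ?_, hsr⟩, ?_⟩
  · set c : Fin m → ℝ := fun i => inner ℝ (ι (u i)) (ι v) with hc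
    set v₁ := ∑ k, c k • u k with hv₁
    have hvZ : v - v₁ ∈ Z := by
      rw [hmem]
      intro i
      rw [map_sub, inner_sub_right, hcomb, sub_self]
    have h1 : A s (v - v₁) = f (v - v₁) := by
      have h2 : A z (v - v₁) = f (v - v₁) - A u₁ (v - v₁) := hz ⟨_, hvZ⟩
      rw [hs, map_add, add_apply, h2]
      ring
    have h3 : A s v₁ - f v₁ = ∑ i, (A s (u i) - f (u i)) * c i := by
      rw [hv₁, map_sum, map_sum, ← Finset.sum_sub_distrib]
      refine Finset.sum_congr rfl fun i _ => ?_
      rw [map_smul, map_smul, smul_eq_mul, smul_eq_mul]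
      ring
    change inner ℝ (g s) (g v) - μ * inner ℝ (ι s) (ι v) -
      ∑ i, (A s (u i) - f (u i)) * c i = f v
    rw [← hA, ← h3]
    rw [map_sub, map_sub] at h1
    linarith
  · rintro ⟨x, y⟩ ⟨h1, h2⟩
    simp only at h1 h2
    set e := y - s with he
    have heZ : ∀ i, inner ℝ (ι (u i)) (ι e) = 0 := by
      intro i
      rw [he, map_sub, inner_sub_right, h2, hsr, sub_self]
    have hAe : A e e = 0 := by
      have h3 : A y e = f e := by
        have h := h1 e
        simp only [heZ, mul_zero, Finset.sum_const_zero, sub_zero] at h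
        rw [hA]; exact h
      have h4 : A z e = f e - A u₁ e := hz ⟨e, (hmem e).2 heZ⟩
      have h5 : A s e = f e := by
        rw [hs, map_add, add_apply, h4]; ring
      have h6 : A e e = A y e - A s e := by
        rw [← sub_apply, ← map_sub]
      rw [h6, h3, h5, sub_self]
    have he0 : e = 0 := by
      have h3 := hco e heZ
      rw [hA, real_inner_self_eq_norm_sq, real_inner_self_eq_norm_sq] at hAe
      rw [hAe] at h3
      have h4 : ‖g e‖ ^ 2 ≤ 0 := by
        by_contra h
        nlinarith
      have h5 := hsq' e
      have h6 : ‖e‖ ^ 2 ≤ 0 := h5.trans (mul_nonpos_of_nonneg_of_nonpos (by positivity) h4)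
      have h7 : ‖e‖ = 0 := by nlinarith [norm_nonneg e]
      exact norm_eq_zero.1 h7
    have hys : y = s := sub_eq_zero.1 he0
    refine Prod.ext (funext fun i => ?_) hys
    have h3 := h1 (u i)
    rw [← hA, hys] at h3
    have h4 : ∑ k, x k * inner ℝ (ι (u k)) (ι (u i)) = x i := by
      simp [hite]
    rw [h4] at h3
    change x i = A s (u i) - f (u i)
    linarith

/-- The saddle-point problem of Newton's method, in terms of the forms `a = ⟪g u, g v⟫` and
`b = ⟪ι u, ι v⟫`. -/
theorem existsUnique_newton [CompleteSpace V]
    (hin : ∀ u v : V, inner ℝ u v = inner ℝ (ι u) (ι v) + inner ℝ (g u) (g v))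
    {C : ℝ} (hC : ∀ v, ‖ι v‖ ≤ C * ‖g v‖) {u : Fin m → V}
    (hu : Orthonormal ℝ fun i => ι (u i)) {μ α : ℝ} (hα : 0 < α)
    (hco : ∀ v, (∀ i, inner ℝ (ι (u i)) (ι v) = 0) →
      α * ‖g v‖ ^ 2 ≤ ‖g v‖ ^ 2 - μ * ‖ι v‖ ^ 2)
    (a b : V → V → ℝ) (ha : ∀ x y, a x y = inner ℝ (g x) (g y))
    (hb : ∀ x y, b x y = inner ℝ (ι x) (ι y)) (x₀ : V) :
    ∃! p : (Fin m → ℝ) × V,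
      (∀ v, a p.2 v - μ * b p.2 v + -∑ i, p.1 i * b (u i) v = -μ * b x₀ v) ∧
      ∀ y : Fin m → ℝ, -∑ i, y i * b (u i) p.2 = -∑ i, y i * b (u i) x₀ := by
  refine (existsUnique_congr fun p => ?_).2 (existsUnique_saddle ι g hin hC hu hα hco
    (-μ • (innerSL ℝ (ι x₀)).comp ι) (fun i => inner ℝ (ι (u i)) (ι x₀)))
  refine and_congr (forall_congr' fun v => ?_) ?_
  · simp only [ha, hb, ← sub_eq_add_neg]
    rfl
  · simp only [hb, neg_inj]
    refine ⟨fun h i => ?_, fun h y => by simp only [h]⟩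
    simpa [Pi.single_apply] using h (Pi.single i 1)

end Saddle

/-! ### Eigenvalues of the Laplacian and the spectral gap. -/

noncomputable section

variable {d : ℕ} {Ω : Set (Euc d)}

theorem aForm_eq (u v : H10 Ω) : aForm u v = inner ℝ (gradL Ω u) (gradL Ω v) :=
  aForm_eq_inner u v

theorem bForm_eq (u v : H10 Ω) : bForm u v = inner ℝ (valL Ω u) (valL Ω v) :=
  bForm_eq_inner u v

theorem aNorm_eq (v : H10 Ω) : aNorm v = ‖gradL Ω v‖ := by
  rw [aNorm, aForm_eq, real_inner_self_eq_norm_sq, Real.sqrt_sq (norm_nonneg _)]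

theorem mem_eigenspace {t : ℝ} {w : H10 Ω} : w ∈ eigenspace Ω t ↔
    ∀ v, inner ℝ (gradL Ω w) (gradL Ω v) = t * inner ℝ (valL Ω w) (valL Ω v) := by
  simp only [← aForm_eq, ← bForm_eq]
  rfl

theorem valL_sub (u v : H10 Ω) : valL Ω (u - v) = valL Ω u - valL Ω v := map_sub (valL Ω) u v

theorem gradL_sub (u v : H10 Ω) : gradL Ω (u - v) = gradL Ω u - gradL Ω v :=
  map_sub (gradL Ω) u v

theorem inner_eq_valL_add_gradL (u v : H10 Ω) :
    inner ℝ u v = inner ℝ (valL Ω u) (valL Ω v) + inner ℝ (gradL Ω u) (gradL Ω v) :=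
  WithLp.prod_inner_apply u.1 v.1

instance : CompleteSpace (H10 Ω) :=
  (Submodule.isClosed_topologicalClosure (testGraph Ω)).completeSpace_coe

/-- For an eigenfunction a(w,w) = s b(w,w), so vanishing in L² kills the whole H¹ norm. -/
theorem eq_zero_of_valL_eq_zero {s : ℝ} {w : H10 Ω} (hw : w ∈ eigenspace Ω s)
    (h : valL Ω w = 0) : w = 0 := by
  have h1 := mem_eigenspace.1 hw w
  have h2 := inner_eq_valL_add_gradL w w
  rw [h1, h, inner_zero_left, mul_zero, add_zero] at h2
  exact inner_self_eq_zero.1 h2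

theorem nonneg_of_mem_eigenspace {s : ℝ} {w : H10 Ω} (hw : w ∈ eigenspace Ω s) (h0 : w ≠ 0) :
    0 ≤ s := by
  have h1 := mem_eigenspace.1 hw w
  rw [real_inner_self_eq_norm_sq, real_inner_self_eq_norm_sq] at h1
  have h2 : 0 < ‖valL Ω w‖ := norm_pos_iff.2 fun h => h0 (eq_zero_of_valL_eq_zero hw h)
  by_contra hs
  nlinarith [sq_nonneg ‖gradL Ω w‖, pow_pos h2 2]

/-- The `t` for which there are `k` independent eigenfunctions with eigenvalues at most `t`. -/
def eigenBounds (Ω : Set (Euc d)) (k : ℕ) : Set ℝ :=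
  {t | ∃ w : Fin k → H10 Ω, LinearIndependent ℝ w ∧ ∀ i, ∃ s ≤ t, w i ∈ eigenspace Ω s}

theorem eigenvalue_eq_sInf (k : ℕ) : eigenvalue Ω k = sInf (eigenBounds Ω k) := rfl

theorem nonneg_of_mem_eigenBounds {k : ℕ} (hk : 1 ≤ k) {t : ℝ} (ht : t ∈ eigenBounds Ω k) :
    0 ≤ t := by
  obtain ⟨w, hw, h⟩ := ht
  obtain ⟨s, hs, hws⟩ := h ⟨0, hk⟩
  exact (nonneg_of_mem_eigenspace hws (hw.ne_zero _)).trans hs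

theorem eigenvalue_nonneg {k : ℕ} (hk : 1 ≤ k) : 0 ≤ eigenvalue Ω k :=
  Real.sInf_nonneg fun _ ht => nonneg_of_mem_eigenBounds hk ht

theorem eigenvalue_le {k : ℕ} (hk : 1 ≤ k) {t : ℝ} (ht : t ∈ eigenBounds Ω k) :
    eigenvalue Ω k ≤ t :=
  csInf_le ⟨0, fun _ hs => nonneg_of_mem_eigenBounds hk hs⟩ ht

theorem eigenBounds_anti {k l : ℕ} (h : k ≤ l) : eigenBounds Ω l ⊆ eigenBounds Ω k := by
  rintro t ⟨w, hw, hs⟩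
  exact ⟨w ∘ Fin.castLE h, hw.comp _ (Fin.castLE_injective h), fun i => hs _⟩

theorem eigenvalue_mono {k l n : ℕ} (hk : 1 ≤ k) (hkl : k ≤ l) (hln : l ≤ n)
    (hn : (eigenBounds Ω n).Nonempty) : eigenvalue Ω k ≤ eigenvalue Ω l :=
  csInf_le_csInf ⟨0, fun _ hs => nonneg_of_mem_eigenBounds hk hs⟩
    (hn.mono (eigenBounds_anti hln)) (eigenBounds_anti hkl)

/-- The real infimum of the empty set is 0, so an empty set of bounds would give λ_{m+1} = 0 ≤ λ_m.
Nonemptiness is what makes the infima monotone in the index. -/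
theorem eigenBounds_nonempty_of_lt {m : ℕ} (hm : 1 ≤ m)
    (hgap : eigenvalue Ω m < eigenvalue Ω (m + 1)) : (eigenBounds Ω (m + 1)).Nonempty := by
  rw [Set.nonempty_iff_ne_empty]
  intro h
  rw [eigenvalue_eq_sInf (m + 1), h, Real.sInf_empty] at hgap
  exact absurd (eigenvalue_nonneg hm) (not_le.2 hgap)

/-- On the complement of `m` independent eigenfunctions with eigenvalues below `λ_{m+1}`, the
Rayleigh quotient is at least `λ_{m+1}`. -/
theorem eigenvalue_mul_le (hΩ : IsOpen Ω) (hb : Bornology.IsBounded Ω) {m : ℕ} {w : Fin m → H10 Ω}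
    (hli : LinearIndependent ℝ w) {t : Fin m → ℝ} {lam : ℝ} (ht : ∀ i, t i ≤ lam)
    (hlam : lam < eigenvalue Ω (m + 1)) (hw : ∀ i, w i ∈ eigenspace Ω (t i)) {z : H10 Ω}
    (hz : ∀ i, inner ℝ (valL Ω (w i)) (valL Ω z) = 0) :
    eigenvalue Ω (m + 1) * ‖valL Ω z‖ ^ 2 ≤ ‖gradL Ω z‖ ^ 2 := by
  by_contra! hlt
  obtain ⟨z₀, hz₀, horth, s, hs, hz₀s⟩ := exists_eigenvector_of_lt (valL Ω) (gradL Ω)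
    (isCompactOperator_valL hΩ hb) inner_eq_valL_add_gradL w t
    (fun i => mem_eigenspace.1 (hw i)) hz hlt
  have hz₀e : z₀ ∈ eigenspace Ω s := mem_eigenspace.2 hz₀s
  have hspan : z₀ ∉ Submodule.span ℝ (Set.range w) := by
    intro h
    have hle : Submodule.span ℝ (Set.range w) ≤
        ((innerSL ℝ (valL Ω z₀)).comp (valL Ω)).ker := by
      rw [Submodule.span_le]
      rintro _ ⟨i, rfl⟩
      change inner ℝ (valL Ω z₀) (valL Ω (w i)) = 0
      rw [real_inner_comm, horth]
    have h1 : inner ℝ (valL Ω z₀) (valL Ω z₀) = 0 := hle h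
    exact hz₀ (eq_zero_of_valL_eq_zero hz₀e (inner_self_eq_zero.1 h1))
  -- Both `lam` and `s` are strictly below λ_{m+1}, so this bound for m + 1 independent
  -- eigenfunctions is too small.
  have hmem : max lam s ∈ eigenBounds Ω (m + 1) := by
    refine ⟨Fin.snoc w z₀, linearIndependent_finSnoc.2 ⟨hli, hspan⟩, fun i => ?_⟩
    refine Fin.lastCases ?_ (fun j => ?_) i
    · exact ⟨s, le_max_right _ _, by simpa using hz₀e⟩
    · exact ⟨t j, (ht j).trans (le_max_left _ _), by simpa using hw j⟩
  exact absurd (eigenvalue_le (by omega) hmem) (not_le.2 (max_lt hlam hs))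

/-! ### The constraint form, its inf-sup bound and Newton's problem. -/

theorem constraintForm_eq {m : ℕ} (u₀ : Fin m → H10 Ω) (v : H10 Ω) (y : Fin m → ℝ) :
    constraintForm u₀ v y = -∑ i, y i * inner ℝ (valL Ω (u₀ i)) (valL Ω v) := by
  simp only [constraintForm, bForm_eq]

theorem shiftedForm_eq (μ : ℝ) (u v : H10 Ω) : shiftedForm μ u v =
    inner ℝ (gradL Ω u) (gradL Ω v) - μ * inner ℝ (valL Ω u) (valL Ω v) := by
  rw [shiftedForm, aForm_eq, bForm_eq]

theorem constraintForm_eq_zero_iff {m : ℕ} (u₀ : Fin m → H10 Ω) (v : H10 Ω) :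
    (∀ y, constraintForm u₀ v y = 0) ↔ ∀ i, bForm (u₀ i) v = 0 := by
  refine ⟨fun h i => ?_, fun h y => by simp [constraintForm, h]⟩
  simpa [constraintForm, Pi.single_apply] using h (Pi.single i 1)

theorem bddAbove_constraintForm {m : ℕ} {u₀ : Fin m → H10 Ω}
    (hu : Orthonormal ℝ fun i => valL Ω (u₀ i)) {C : ℝ}
    (hC : ∀ v : H10 Ω, ‖valL Ω v‖ ≤ C * ‖gradL Ω v‖) (hC0 : 0 ≤ C) (y : Fin m → ℝ) :
    BddAbove (Set.range fun v : {v : H10 Ω // v ≠ 0} =>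
      constraintForm u₀ v.1 y / aNorm v.1) := by
  refine ⟨∑ i, |y i| * C, ?_⟩
  rintro _ ⟨v, rfl⟩
  dsimp only
  rw [aNorm_eq]
  refine div_le_of_le_mul₀ (norm_nonneg _) (by positivity) ?_
  rw [constraintForm_eq, Finset.sum_mul]
  refine (neg_le_abs _).trans ((Finset.abs_sum_le_sum_abs _ _).trans ?_)
  refine Finset.sum_le_sum fun i _ => ?_
  rw [abs_mul, mul_assoc]
  gcongr
  refine (abs_real_inner_le_norm _ _).trans ?_
  rw [hu.1 i, one_mul]
  exact hC v.1

theorem norm_gradL_pos {C : ℝ} (hC : ∀ v : H10 Ω, ‖valL Ω v‖ ≤ C * ‖gradL Ω v‖) {u : H10 Ω}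
    (hu : ‖valL Ω u‖ = 1) : 0 < ‖gradL Ω u‖ := by
  refine (norm_nonneg _).lt_of_ne fun h => ?_
  have h1 := hC u
  rw [hu, ← h] at h1
  linarith

/-- By orthonormality B(∓u_{0,i}, y) = ±y_i, so one of these two test functions gives |y_i| /
‖u_{0,i}‖_a ≥ |y_i| / √μ. As ‖y‖ is a maximum, treating each i separately suffices. -/
theorem infsup_constraintForm {m : ℕ} {u₀ : Fin m → H10 Ω}
    (hu : Orthonormal ℝ fun i => valL Ω (u₀ i)) {C : ℝ}
    (hC : ∀ v : H10 Ω, ‖valL Ω v‖ ≤ C * ‖gradL Ω v‖) (hC0 : 0 ≤ C) (hm : 1 ≤ m) {μ : ℝ} (hμ : 0 < μ)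
    (hle : ∀ i, ‖gradL Ω (u₀ i)‖ ^ 2 ≤ μ) (y : Fin m → ℝ) :
    1 / Real.sqrt μ * ‖y‖ ≤
      ⨆ v : {v : H10 Ω // v ≠ 0}, constraintForm u₀ v.1 y / aNorm v.1 := by
  set S := ⨆ v : {v : H10 Ω // v ≠ 0}, constraintForm u₀ v.1 y / aNorm v.1
  have hsμ : 0 < Real.sqrt μ := Real.sqrt_pos.2 hμ
  have hite : ∀ i j, inner ℝ (valL Ω (u₀ i)) (valL Ω (u₀ j)) = if i = j then (1 : ℝ) else 0 :=
    orthonormal_iff_ite.1 hu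
  have hbd := bddAbove_constraintForm hu hC hC0 y
  have key : ∀ i, |y i| ≤ Real.sqrt μ * S := by
    intro i
    obtain ⟨v, hv, hB, ha⟩ : ∃ v : H10 Ω, v ≠ 0 ∧ constraintForm u₀ v y = |y i| ∧
        ‖gradL Ω v‖ = ‖gradL Ω (u₀ i)‖ := by
      have hne : u₀ i ≠ 0 := by
        intro h
        have := hu.1 i
        simp [h] at this
      rcases le_total 0 (y i) with h | h
      · refine ⟨-u₀ i, neg_ne_zero.2 hne, ?_, by rw [map_neg, norm_neg]⟩
        simp [constraintForm_eq, hite, abs_of_nonneg h]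
      · refine ⟨u₀ i, hne, ?_, rfl⟩
        simp [constraintForm_eq, hite, abs_of_nonpos h]
    have h1 := le_ciSup hbd ⟨v, hv⟩
    dsimp only at h1
    rw [hB, aNorm_eq, ha] at h1
    have h2 : ‖gradL Ω (u₀ i)‖ ≤ Real.sqrt μ := Real.le_sqrt_of_sq_le (hle i)
    have h3 : 0 < ‖gradL Ω (u₀ i)‖ := norm_gradL_pos hC (hu.1 i)
    rw [div_le_iff₀ h3] at h1
    have hS : 0 ≤ S := by
      by_contra h5
      nlinarith [abs_nonneg (y i)]
    exact h1.trans (by rw [mul_comm]; gcongr)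
  have h0 : 0 ≤ Real.sqrt μ * S := (abs_nonneg _).trans (key ⟨0, hm⟩)
  rw [one_div, inv_mul_le_iff₀ hsμ]
  exact (pi_norm_le_iff_of_nonneg h0).2 key

theorem existsUnique_solvesNewton {m : ℕ} {u₀ : Fin m → H10 Ω}
    (hu : Orthonormal ℝ fun i => valL Ω (u₀ i)) {C : ℝ}
    (hC : ∀ v : H10 Ω, ‖valL Ω v‖ ≤ C * ‖gradL Ω v‖) {α : ℝ} (hα : 0 < α) (j : Fin m)
    (hco : ∀ v, (∀ i, inner ℝ (valL Ω (u₀ i)) (valL Ω v) = 0) →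
      α * ‖gradL Ω v‖ ^ 2 ≤ ‖gradL Ω v‖ ^ 2 - rayleigh (u₀ j) * ‖valL Ω v‖ ^ 2) :
    ∃! p : (Fin m → ℝ) × H10 Ω, SolvesNewton u₀ j p.1 p.2 := by
  exact existsUnique_newton (valL Ω) (gradL Ω) inner_eq_valL_add_gradL hC hu hα hco aForm bForm
    aForm_eq bForm_eq (u₀ j)

end

end NewtonEig

/-! ### The main theorem: choice of δ and α. -/

open NewtonEig in
set_option maxHeartbeats 1000000 in
theorem mainTheorem4 (d : ℕ) (hd : 1 ≤ d) (Ω : Set (Euc d)) (hΩo : IsOpen Ω)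
    (hΩb : Bornology.IsBounded Ω) (m : ℕ) (hm : 1 ≤ m)
    (hgap : eigenvalue Ω m < eigenvalue Ω (m + 1)) :
    ∃ δ > 0, ∃ α > 0, ∀ u₀ : Fin m → H10 Ω,
      (∀ i j, bForm (u₀ i) (u₀ j) = if i = j then 1 else 0) →
      (∀ j : Fin m, ∃ w ∈ eigenspace Ω (eigenvalue Ω (j + 1)), aNorm (u₀ j - w) ≤ δ) →
      -- the kernel of `B` is the common `b`-orthogonal complement of the `u₀ i`
      (∀ v : H10 Ω, (∀ y, constraintForm u₀ v y = 0) ↔ ∀ i, bForm (u₀ i) v = 0) ∧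
      -- coercivity of each `A_{μ_j}` on it
      (∀ (j : Fin m) (v : H10 Ω), (∀ y, constraintForm u₀ v y = 0) →
        α * aNorm v ^ 2 ≤ shiftedForm (rayleigh (u₀ j)) v v) ∧
      -- the inf-sup condition (`‖y‖` is the maximum of the `|y i|`)
      (0 < ⨆ t, rayleigh (u₀ t)) ∧
      (∀ y : Fin m → ℝ,
        BddAbove (Set.range fun v : {v : H10 Ω // v ≠ 0} =>
          constraintForm u₀ v.1 y / aNorm v.1) ∧
        1 / Real.sqrt (⨆ t, rayleigh (u₀ t)) * ‖y‖ ≤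
          ⨆ v : {v : H10 Ω // v ≠ 0}, constraintForm u₀ v.1 y / aNorm v.1) ∧
      (1 ≤ (⨆ t, rayleigh (u₀ t)) → ∀ y : Fin m → ℝ,
        1 / (⨆ t, rayleigh (u₀ t)) * ‖y‖ ≤
          ⨆ v : {v : H10 Ω // v ≠ 0}, constraintForm u₀ v.1 y / aNorm v.1) ∧
      -- unique solvability of every Newton saddle-point problem
      (∀ j : Fin m, ∃! p : (Fin m → ℝ) × H10 Ω, SolvesNewton u₀ j p.1 p.2) := by
  obtain ⟨C, hC0, hC⟩ := exists_poincare hd hΩo hΩb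
  replace hC : ∀ v : H10 Ω, ‖valL Ω v‖ ≤ C * ‖gradL Ω v‖ := hC
  have hne := eigenBounds_nonempty_of_lt hm hgap
  set lam := eigenvalue Ω m with hlam
  set Λ := eigenvalue Ω (m + 1) with hΛ
  have hlam0 : 0 ≤ lam := eigenvalue_nonneg hm
  have hΛ0 : 0 ≤ Λ := hlam0.trans hgap.le
  obtain ⟨δ, hδ, hδ1, hδ2⟩ := exists_small_delta m (C := C) hlam0 hgap
  set M := (Real.sqrt lam * (1 + C * δ) + δ) ^ 2 with hM
  set N := Λ * (1 - (2 * m * (C * δ)) ^ 2) with hN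
  have hM0 : 0 ≤ M := sq_nonneg _
  have hN0 : 0 < N := hM0.trans_lt hδ2
  have hα : 0 < 1 - M / N := by
    rw [sub_pos, div_lt_one hN0]
    exact hδ2
  refine ⟨δ, hδ, 1 - M / N, hα, fun u₀ horth hclose => ?_⟩
  have hu : Orthonormal ℝ fun i => valL Ω (u₀ i) := by
    rw [orthonormal_iff_ite]
    intro i j
    rw [← bForm_eq]
    exact horth i j
  choose w hw hwδ using hclose
  have hgδ : ∀ i, ‖gradL Ω (u₀ i) - gradL Ω (w i)‖ ≤ δ := fun i => by
    have h := hwδ i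
    rwa [aNorm_eq, gradL_sub] at h
  have hvδ : ∀ i, ‖valL Ω (u₀ i) - valL Ω (w i)‖ ≤ C * δ := fun i => by
    have h := hC (u₀ i - w i)
    rw [gradL_sub, valL_sub] at h
    exact h.trans (mul_le_mul_of_nonneg_left (hgδ i) hC0.le)
  have hli : LinearIndependent ℝ w :=
    LinearIndependent.of_comp (valL Ω).toLinearMap
      (linearIndependent_of_near_orthonormal hu hvδ hδ1)
  have ht : ∀ i : Fin m, eigenvalue Ω (i + 1) ≤ lam := fun i =>
    eigenvalue_mono (by omega) (by omega) (Nat.le_succ m) hne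
  have hray : ∀ i, rayleigh (u₀ i) = ‖gradL Ω (u₀ i)‖ ^ 2 := fun i => by
    rw [rayleigh, horth, if_pos rfl, div_one, aForm_eq, real_inner_self_eq_norm_sq]
  have hrayM : ∀ i, rayleigh (u₀ i) ≤ M := fun i => by
    rw [hray]
    have h := mem_eigenspace.1 (hw i) (w i)
    rw [real_inner_self_eq_norm_sq, real_inner_self_eq_norm_sq] at h
    exact norm_sq_le_of_near_eigenvector (valL Ω) (gradL Ω) (eigenvalue_nonneg (by omega)) (ht i)
      h (hu.1 i) (hvδ i) (hgδ i)
  have hco : ∀ j v, (∀ i, inner ℝ (valL Ω (u₀ i)) (valL Ω v) = 0) →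
      (1 - M / N) * ‖gradL Ω v‖ ^ 2 ≤
        ‖gradL Ω v‖ ^ 2 - rayleigh (u₀ j) * ‖valL Ω v‖ ^ 2 := by
    intro j v hv
    have h1 : N * ‖valL Ω v‖ ^ 2 ≤ ‖gradL Ω v‖ ^ 2 :=
      gap_of_near (valL Ω) (gradL Ω) hΛ0 (fun i => mem_eigenspace.1 (hw i)) hu hvδ hδ1
        (fun z hz => eigenvalue_mul_le hΩo hΩb hli ht hgap hw hz) hv
    -- The μ_j-term takes up at most the fraction M/N < 1 of ‖v‖_a², leaving α = 1 - M/N.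
    have h2 : rayleigh (u₀ j) * ‖valL Ω v‖ ^ 2 ≤ M / N * ‖gradL Ω v‖ ^ 2 := by
      calc rayleigh (u₀ j) * ‖valL Ω v‖ ^ 2 ≤ M * ‖valL Ω v‖ ^ 2 := by
            gcongr; exact hrayM j
        _ = M / N * (N * ‖valL Ω v‖ ^ 2) := by field_simp
        _ ≤ _ := by gcongr
    linarith
  have hrle : ∀ i, ‖gradL Ω (u₀ i)‖ ^ 2 ≤ ⨆ t, rayleigh (u₀ t) := fun i => by
    rw [← hray]
    exact le_ciSup (f := fun t => rayleigh (u₀ t)) (Set.finite_range _).bddAbove i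
  have hμ : 0 < ⨆ t, rayleigh (u₀ t) :=
    (pow_pos (norm_gradL_pos hC (hu.1 ⟨0, hm⟩)) 2).trans_le (hrle ⟨0, hm⟩)
  refine ⟨constraintForm_eq_zero_iff u₀, fun j v hv => ?_, hμ, fun y =>
    ⟨bddAbove_constraintForm hu hC hC0.le y, infsup_constraintForm hu hC hC0.le hm hμ hrle y⟩,
    fun h1 y => ?_, fun j => existsUnique_solvesNewton hu hC hα j (hco j)⟩
  · rw [aNorm_eq, shiftedForm_eq, real_inner_self_eq_norm_sq, real_inner_self_eq_norm_sq]
    refine hco j v fun i => ?_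
    rw [← bForm_eq]
    exact (constraintForm_eq_zero_iff u₀ v).1 hv i
  · refine le_trans ?_ (infsup_constraintForm hu hC hC0.le hm hμ hrle y)
    gcongr
    -- For μ ≥ 1 one has √μ ≤ μ, so the constant 1/μ is the weaker one.
    exact Real.sqrt_le_iff.2 ⟨hμ.le, by nlinarith⟩
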